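/- **Setting.** All systems are finite dimensional. A non-trivial elementary system $A$ has a Hilbert space $\mathcal H_A=\mathbb C^{d_A}$ with $d_A\ge 2$ and a fixed orthonormal basis; there are infinitely many copies of each dimension. For a finite set $S$ of such systems let $\mathcal H_S=\bigotimes_{A\in S}\mathcal H_A$ (the order of factors is disregarded) and let $\mathcal L(\mathcal H_S)$ be the space of linear operators on it; $\mathcal H_\emptyset=\mathbb C$ is the trivial system $I$. An *elementary type* is a finite set of non-trivial elementary systems, regarded as their joint system. *Types* are the elementary types and, recursively, the words $(x\to y)$ for types $x,y$. $\mathsf{Ele}_x$ is the set of non-trivial elementary systems occurring in $x$; in every type considered, no non-trivial elementary system occurs more than once. For $A\in\mathsf{Ele}_x$ let $K_x(A)$ be the number, modulo 2, of arrows "$\to$" and open round brackets "$($" to the right of $A$ in the expression of $x$; $\mathsf{in}_x=\{A\in\mathsf{Ele}_x: K_x(A)=1\}$ is the set of inputs and $\mathsf{out}_x=\mathsf{Ele}_x\setminus\mathsf{in}_x$ the set of outputs. **Link product.** For $R\in\mathcal L(\mathcal H_S)$ and $T\in\mathcal L(\mathcal H_{S'})$, $R*T=\operatorname{Tr}_{S\cap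 S'}\big[(R\otimes I_{S'\setminus S})(I_{S\setminus S'}\otimes T^{\theta_{S\cap S'}})\big]$, where $\theta_{S\cap S'}$ is the partial transposition on the common systems. Linear maps $\mathcal M:\mathcal L(\mathcal H_X)\to\mathcal L(\mathcal H_Y)$ are identified with their Choi operators $M\in\mathcal L(\mathcal H_{X\cup Y})$, so that $(\mathcal M\otimes\mathcal I_E)(\rho)=\rho*M$. **Admissible maps $\mathsf T(x)$ and deterministic maps $\mathsf T_1(x)$**, both contained in $\mathcal L(\mathcal H_{\mathsf{Ele}_x})$. For an elementary type $A$: $\mathsf T_1(A)$ is the set of density operators on $\mathcal H_A$, and $\mathsf T(A)=\{M\ge 0: M\le N \text{ for some } N\in\mathsf T_1(A)\}$. The extension of a type by an elementary type $E$ (with systems not occurring in it) is $A\|E=AE$ for $A$ elementary, and $(x\to y)\|E=x\to(y\|E)$. Call $M\in\mathcal L(\mathcal H_{\mathsf{Ele}_{x\to y}})$ *completely admissible-preserving* if, for every elementary type $E$ (with systems occurring in neither $x$ nor $y$), $\mathcal M\otimes\mathcal I_E$ sends $\mathsf T(x\|E)$ into $\mathsf T(y\|E)$, and *completely determinism-preserving*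 if, for every such $E$, it sends $\mathsf T_1(x\|E)$ into $\mathsf T_1(y\|E)$. Then $M\in\mathsf T(x\to y)$ iff $M$ is completely admissible-preserving and there are finitely many (possibly no) completely admissible-preserving $N_1,\dots,N_n$ such that $M+\sum_iN_i$ is completely determinism-preserving; and $M\in\mathsf T_1(x\to y)$ iff $M\in\mathsf T(x\to y)$ and $M$ is completely determinism-preserving. For elementary types $P,Q$ the elements of $\mathsf T_1(P\to Q)$ are the deterministic channels from $P$ to $Q$. **Contraction.** For distinct $A,B\in\mathsf{Ele}_x$ with $d_A=d_B$ and $R\in\mathcal L(\mathcal H_{\mathsf{Ele}_x})$ let $\mathcal C_{AB}(R)=R*\Phi_{AB}$ with $\Phi_{AB}=\sum_{i,j}|ii\rangle\langle jj|\in\mathcal L(\mathcal H_A\otimes\mathcal H_B)$. The contraction $\mathcal C_{AB}(x)$ is *admissible* if for every $R\in\mathsf T_1(x)$ there is a type $z$ with $\mathcal C_{AB}(R)\in\mathsf T_1(z)$. **Proposition.** Let $x$ be a type and let $A,B\in\mathsf{Ele}_x$ be distinct with $d_A=d_B$. 1. If $A,B\in\mathsf{in}_x$ or $A,B\in\mathsf{out}_x$,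 then $\mathcal C_{AB}(x)$ is not admissible. 2. If $A\in\mathsf{in}_x$ and $B\in\mathsf{out}_x$, then $\mathcal C_{AB}(x)$ is admissible if and only if $\mathcal C_{AB}(R)\in\mathsf T_1\big((\mathsf{in}_x\setminus\{A\})\to(\mathsf{out}_x\setminus\{B\})\big)$ for every $R\in\mathsf T_1(x)$. -/

import Mathlib

open Finset
open scoped ComplexOrder

/-- A non-trivial elementary quantum system: a label together with the dimension (at least two) of
its finite dimensional Hilbert space `ℂ ^ dim`, in which an orthonormal basis is fixed. There are
infinitely many copies of each dimension, so that every type expression can be labelled without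
repetition and fresh ancillary systems of every dimension are always available. -/
structure QSystem where
  dim : ℕ
  two_le_dim : 2 ≤ dim
  label : ℕ
  deriving DecidableEq

/-- Basis labels of the Hilbert space `H_S`, the tensor product of the systems in `S`. For `S = ∅`
there is exactly one, i.e. `H_∅ = ℂ` is the trivial system `I`. -/
abbrev Conf (S : Finset QSystem) : Type := (i : S) → Fin i.1.dim

/-- The algebra `L(H_S)` of linear operators on `H_S`. Since `S` is an unordered set of systems,
`H ⊗ K` and `K ⊗ H` are identified. -/
abbrev Op (S : Finset QSystem) : Type := Matrix (Conf S) (Conf S) ℂ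

/-- The basis label of `H_S` that agrees with `s` on the systems of `U` and with `c` elsewhere. -/
def glue {S T U : Finset QSystem} (h : S ⊆ T ∪ U) (c : Conf T) (s : Conf U) : Conf S :=
  fun i => if hi : i.1 ∈ U then s ⟨i.1, hi⟩
    else c ⟨i.1, (Finset.mem_union.1 (h i.2)).resolve_right hi⟩

theorem subset_link_left (S T : Finset QSystem) : S ⊆ ((S \ T) ∪ (T \ S)) ∪ (S ∩ T) := by
  intro i hi
  by_cases hT : i ∈ T <;> simp [hi, hT]

theorem subset_link_right (S T : Finset QSystem) : T ⊆ ((S \ T) ∪ (T \ S)) ∪ (S ∩ T) := by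
  intro i hi
  by_cases hS : i ∈ S <;> simp [hi, hS]

/-- The link product `P * Q = Tr_{S ∩ T}[(P ⊗ I)(I ⊗ Q^θ)]` of `P ∈ L(H_S)` and `Q ∈ L(H_T)`, where
`θ` is the partial transposition on the shared systems, written in coordinates:
`⟨c| P * Q |c'⟩ = ∑_{s, s'} ⟨c s| P |c' s'⟩ ⟨c s| Q |c' s'⟩`, the sum being over the basis labels of
the shared systems `S ∩ T`. If no system is shared this is `P ⊗ Q`. -/
noncomputable def link {S T : Finset QSystem} (P : Op S) (Q : Op T) : Op ((S \ T) ∪ (T \ S)) :=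
  Matrix.of fun c c' => ∑ s : Conf (S ∩ T), ∑ s' : Conf (S ∩ T),
    P (glue (subset_link_left S T) c s) (glue (subset_link_left S T) c' s') *
      Q (glue (subset_link_right S T) c s) (glue (subset_link_right S T) c' s')

/-- Types of higher order maps. An elementary type is a quantum system, given as the tensor product
of a finite set of non-trivial systems; `elem ∅` is the trivial type `I`, and `elem {A, B}` is the
bipartite system `AB`. -/
inductive HType : Type
  | elem (A : Finset QSystem) : HType
  | arrow (x y : HType) : HType

namespace HType

/-- `Ele_x`: the set of non-trivial elementary systems that occur in the expression of `x`. -/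
def ele : HType → Finset QSystem
  | elem A => A
  | arrow x y => x.ele ∪ y.ele

/-- No non-trivial elementary system occurs more than once in the expression of the type (the
trivial system may occur any number of times). -/
def NoRepeat : HType → Prop
  | elem _ => True
  | arrow x y => x.NoRepeat ∧ y.NoRepeat ∧ Disjoint x.ele y.ele

/-- The extension `x || E` of `x` by an elementary type `E`:
`A || E = AE` and `(x → y) || E = x → (y || E)`. -/
def ext : HType → Finset QSystem → HType
  | elem A, E => elem (A ∪ E)
  | arrow x y, E => arrow x (y.ext E)

/-- The number of arrows of a type. -/
def arrows : HType → ℕ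
  | elem _ => 0
  | arrow x y => x.arrows + y.arrows + 1

theorem arrows_ext (x : HType) (E : Finset QSystem) : (x.ext E).arrows = x.arrows := by
  induction x with
  | elem A => rfl
  | arrow x y _ ihy => simp [ext, arrows, ihy]

/-- The alphabet in which types are written. -/
inductive Letter : Type
  | sys (A : Finset QSystem) : Letter
  | lpar : Letter
  | rpar : Letter
  | arr : Letter

/-- The letter is an elementary type that has the system `A` as a factor. -/
def Letter.hasSystem (A : QSystem) : Letter → Bool
  | sys S => decide (A ∈ S)
  | _ => false

/-- The letter is an arrow or an open round bracket. -/
def Letter.isArrowOrOpen : Letter → Bool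
  | lpar => true
  | arr => true
  | _ => false

/-- The expression of a type as a word: `A` for an elementary type, `(x → y)` otherwise. -/
def word : HType → List Letter
  | elem A => [Letter.sys A]
  | arrow x y => [Letter.lpar] ++ x.word ++ [Letter.arr] ++ y.word ++ [Letter.rpar]

/-- `K_x(A)`: the number, modulo 2, of arrows and open round brackets to the right of `A` in the
expression of `x`. -/
def K (x : HType) (A : QSystem) : ℕ :=
  ((x.word.dropWhile fun l => !(l.hasSystem A)).countP Letter.isArrowOrOpen) % 2

/-- `in_x`: the input systems of `x`. -/
def inputs (x : HType) : Finset QSystem := x.ele.filter fun A => x.K A = 1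

/-- `out_x`: the output systems of `x`. -/
def outputs (x : HType) : Finset QSystem := x.ele \ x.inputs

end HType

/-- A pair of sets of operators: the admissible and the deterministic maps of some type. They are
predicates on operators on any `H_S`; that `S` is the right set of systems is part of them. -/
structure MapClass where
  adm : ∀ S : Finset QSystem, Op S → Prop
  det : ∀ S : Finset QSystem, Op S → Prop

namespace MapClass

/-- Maps of an elementary type `A`: deterministic are the density operators on `H_A`, admissible are
the positive operators below a density operator. -/
def elementary (A : Finset QSystem) : MapClass where
  adm S M := S = A ∧ M.PosSemidef ∧ ∃ N : Op S, (N.PosSemidef ∧ N.trace = 1) ∧ (N - M).PosSemidef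
  det S M := S = A ∧ M.PosSemidef ∧ M.trace = 1

/-- `M` is the Choi operator of a linear map `𝓜` from `L(H_X)` to `L(H_Y)`. For each elementary
system `E` (disjoint from `X` and `Y`), `𝓜 ⊗ 𝓘_E` sends the operators in `P E` to operators
in `Q E`. The operator `(𝓜 ⊗ 𝓘_E)(ρ)` is `link ρ M`, whose entries are
`∑_{a, a'} ⟨a e| ρ |a' e'⟩ ⟨a b| M |a' b'⟩`, where `⟨a b| M |a' b'⟩ = ⟨b| 𝓜(|a⟩⟨a'|) |b'⟩`. -/
def Preserves (X Y : Finset QSystem) (P Q : Finset QSystem → ∀ S : Finset QSystem, Op S → Prop)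
    {S : Finset QSystem} (M : Op S) : Prop :=
  ∀ E : Finset QSystem, Disjoint E (X ∪ Y) →
    ∀ (S' : Finset QSystem) (ρ : Op S'), P E S' ρ → Q E _ (link ρ M)

/-- The admissible maps of type `x → y`, where `Ele_x = X`, `Ele_y = Y`, and `P E`, `Q E` are the
maps of type `x || E` and `y || E`: `M` is completely admissible preserving, and there are finitely
many completely admissible preserving maps `N i` such that `M + ∑ i, N i` sends deterministic maps of
type `x || E` to deterministic maps of type `y || E` for all `E`. -/
def ArrowAdmissible (X Y : Finset QSystem) (P Q : Finset QSystem → MapClass)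
    (S : Finset QSystem) (M : Op S) : Prop :=
  S = X ∪ Y ∧
    Preserves X Y (fun E => (P E).adm) (fun E => (Q E).adm) M ∧
    ∃ (n : ℕ) (N : Fin n → Op S),
      (∀ i, Preserves X Y (fun E => (P E).adm) (fun E => (Q E).adm) (N i)) ∧
      Preserves X Y (fun E => (P E).det) (fun E => (Q E).det) (M + ∑ i, N i)

/-- Maps of type `x → y` (with `X`, `Y`, `P`, `Q` as above). A map is deterministic if it is
admissible and sends deterministic maps of type `x || E` to deterministic maps of type `y || E` for
all `E`. -/
def arrow (X Y : Finset QSystem) (P Q : Finset QSystem → MapClass) : MapClass where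
  adm S M := ArrowAdmissible X Y P Q S M
  det S M := ArrowAdmissible X Y P Q S M ∧
    Preserves X Y (fun E => (P E).det) (fun E => (Q E).det) M

end MapClass

namespace HType

/-- The admissible and the deterministic maps of a type, by recursion on the number of arrows. -/
def maps : HType → MapClass
  | elem A => MapClass.elementary A
  | arrow x y => MapClass.arrow x.ele y.ele (fun E => (x.ext E).maps) (fun E => (y.ext E).maps)
termination_by x => x.arrows
decreasing_by
  · rw [arrows_ext, arrows]; omega
  · rw [arrows_ext, arrows]; omega

/-- `M ∈ T(x)`: `M` is an admissible map of type `x`. -/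
def IsAdmissible (x : HType) {S : Finset QSystem} (M : Op S) : Prop := x.maps.adm S M

/-- `M ∈ T₁(x)`: `M` is a deterministic map of type `x`. -/
def IsDeterministic (x : HType) {S : Finset QSystem} (M : Op S) : Prop := x.maps.det S M

end HType

/-- `Φ_AB = ∑_{i, j} |ii⟩⟨jj|` on `H_A ⊗ H_B` (meant for distinct `A`, `B` of equal dimension). -/
def phi (A B : QSystem) : Op {A, B} :=
  Matrix.of fun c c' =>
    if (c ⟨A, by simp⟩ : ℕ) = c ⟨B, by simp⟩ ∧ (c' ⟨A, by simp⟩ : ℕ) = c' ⟨B, by simp⟩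
    then 1 else 0

/-- The contraction `C_AB(R) = R * Φ_AB`. If `A, B ∈ S`, it is an operator on the systems of `S`
other than `A` and `B`. -/
noncomputable def contract (A B : QSystem) {S : Finset QSystem} (R : Op S) :
    Op ((S \ {A, B}) ∪ ({A, B} \ S)) :=
  link R (phi A B)

/-- The contraction `C_AB(x)` is admissible: for each deterministic map `R` of type `x` there is a
type `z` such that `C_AB(R)` is a deterministic map of type `z`. -/
def ContractionAdmissible (A B : QSystem) (x : HType) : Prop :=
  ∀ R : Op x.ele, x.IsDeterministic R →
    ∃ z : HType, z.NoRepeat ∧ z.IsDeterministic (contract A B R)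

/-! ### Input and output systems of a type -/

namespace HType

/-! The whole argument rests on sandwiching the deterministic maps of a type between two sets that
see only its inputs I and outputs O. Every deterministic map is a positive channel from I to O, and
every operator `σ ⊗ 1` with σ a state on O and 1 the identity on I is deterministic. Together with
convexity and the description of admissible maps as positive operators below a deterministic one,
this is `Regular`, proved for all types by induction on arrows (`NoRepeat.regular`). The two halves
feed each other: testing a map of type `x → y` on pure states of O_x gives the channel condition,
and composing a channel with `σ ⊗ 1` gives again such an operator (`IsStateOn.glink`). Complete
admissibility preservation becomes positivity by Choi's argument (`pos_of_presAdm`).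

Contracting two outputs of a suitable pure basis state gives 0, and contracting two inputs of
`|0⟩⟨0| ⊗ 1` gives a diagonal entry larger than 1; neither is a channel of any kind.

For an input A and an output B, the type z allowed by admissibility may depend on R. To pin down its
inputs, mix R with F₀ = `|0⟩⟨0| ⊗ 1` in infinitely many proportions. Only finitely many sets of
inputs are available, so two mixtures share one, and by linearity the contractions of both R and F₀
are channels for it (`isChannel_of_combinations`). The contraction of F₀ is again `|0⟩⟨0| ⊗ 1` on
the remaining systems (`gcontract_pureOn`), which is a channel for only one choice of inputs
(`eq_of_isChannel_pureOn`). A positive channel between elementary types is deterministic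
(`IsChannel.elem_arrow_elem`). Conversely, the arrow type itself serves as z. -/

theorem countP_word_even (x : HType) : x.word.countP Letter.isArrowOrOpen % 2 = 0 := by
  induction x with
  | elem A => simp [word, Letter.isArrowOrOpen]
  | arrow x y hx hy =>
    simp only [word, List.countP_append, List.countP_cons, List.countP_nil, Letter.isArrowOrOpen]
    simp
    omega

theorem exists_hasSystem_iff (x : HType) (A : QSystem) :
    (∃ l ∈ x.word, l.hasSystem A = true) ↔ A ∈ x.ele := by
  induction x with
  | elem S => simp [word, ele, Letter.hasSystem]
  | arrow x y hx hy =>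
    simp only [ele, mem_union, ← hx, ← hy, word, List.mem_append, List.mem_singleton]
    constructor
    · rintro ⟨l, (((rfl | h) | rfl) | h) | rfl, hl⟩
      · simp [Letter.hasSystem] at hl
      · exact .inl ⟨l, h, hl⟩
      · simp [Letter.hasSystem] at hl
      · exact .inr ⟨l, h, hl⟩
      · simp [Letter.hasSystem] at hl
    · rintro (⟨l, h, hl⟩ | ⟨l, h, hl⟩)
      · exact ⟨l, by simp [h], hl⟩
      · exact ⟨l, by simp [h], hl⟩

theorem dropWhile_append_of_exists {α : Type*} {p : α → Bool} {l₁ l₂ : List α}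
    (h : ∃ a ∈ l₁, p a = true) :
    (l₁ ++ l₂).dropWhile (fun a => !p a) = l₁.dropWhile (fun a => !p a) ++ l₂ := by
  induction l₁ with
  | nil => simp at h
  | cons a l ih =>
    by_cases ha : p a = true
    · simp [ha]
    · obtain ⟨b, hb, hpb⟩ := h
      have hb' : b ∈ l := by
        rcases List.mem_cons.1 hb with rfl | h
        · exact absurd hpb ha
        · exact h
      simp [ha, ih ⟨b, hb', hpb⟩]

theorem dropWhile_append_of_forall {α : Type*} {p : α → Bool} {l₁ l₂ : List α}
    (h : ¬ ∃ a ∈ l₁, p a = true) :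
    (l₁ ++ l₂).dropWhile (fun a => !p a) = l₂.dropWhile (fun a => !p a) := by
  induction l₁ with
  | nil => simp
  | cons a l ih =>
    have ha : ¬ p a = true := fun ha => h ⟨a, by simp, ha⟩
    have hl : ¬ ∃ a ∈ l, p a = true := fun ⟨b, hb, hpb⟩ => h ⟨b, by simp [hb], hpb⟩
    simp [ha, ih hl]

/-- To the right of A there remain the rest of x, the middle arrow, and y, whose own count is even.
The arrow alone flips the parity, so passing to the left of an arrow exchanges inputs and outputs.
-/
theorem K_arrow_left {x y : HType} {A : QSystem} (hA : A ∈ x.ele) :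
    (arrow x y).K A = (x.K A + 1) % 2 := by
  have hx := (exists_hasSystem_iff x A).2 hA
  have hy := countP_word_even y
  simp only [K, word, List.append_assoc]
  rw [dropWhile_append_of_forall (by simp [Letter.hasSystem]), dropWhile_append_of_exists hx]
  simp only [List.countP_append, List.countP_cons, List.countP_nil, Letter.isArrowOrOpen]
  simp
  omega

theorem K_arrow_right {x y : HType} {A : QSystem} (hA : A ∈ y.ele) (hA' : A ∉ x.ele) :
    (arrow x y).K A = y.K A := by
  have hy := (exists_hasSystem_iff y A).2 hA
  have hx : ¬ _ := fun h => hA' ((exists_hasSystem_iff x A).1 h)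
  simp only [K, word, List.append_assoc]
  rw [dropWhile_append_of_forall (by simp [Letter.hasSystem]), dropWhile_append_of_forall hx,
    dropWhile_append_of_forall (by simp [Letter.hasSystem]), dropWhile_append_of_exists hy]
  simp only [List.countP_append, List.countP_cons, List.countP_nil, Letter.isArrowOrOpen]
  simp

theorem inputs_subset_ele (x : HType) : x.inputs ⊆ x.ele := filter_subset _ _

theorem outputs_subset_ele (x : HType) : x.outputs ⊆ x.ele := sdiff_subset

theorem inputs_union_outputs (x : HType) : x.inputs ∪ x.outputs = x.ele :=
  union_sdiff_of_subset x.inputs_subset_ele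

theorem disjoint_inputs_outputs (x : HType) : Disjoint x.inputs x.outputs := disjoint_sdiff

theorem inputs_elem (S : Finset QSystem) : (elem S).inputs = ∅ := by
  refine filter_eq_empty_iff.2 fun A hA => ?_
  have hA : A ∈ S := hA
  simp [K, word, Letter.hasSystem, hA, Letter.isArrowOrOpen]

theorem outputs_elem (S : Finset QSystem) : (elem S).outputs = S := by
  simp [outputs, inputs_elem, ele]

theorem inputs_arrow {x y : HType} (h : Disjoint x.ele y.ele) :
    (arrow x y).inputs = x.outputs ∪ y.inputs := by
  ext A
  have hd : A ∈ x.ele → A ∉ y.ele := fun h1 h2 => disjoint_left.1 h h1 h2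
  by_cases hx : A ∈ x.ele
  · have hy := hd hx
    simp only [inputs, outputs, ele, mem_union, mem_filter, mem_sdiff, hx, hy, K_arrow_left hx]
    have : x.K A < 2 := Nat.mod_lt _ (by norm_num)
    simp
    omega
  · by_cases hy : A ∈ y.ele
    · simp [inputs, outputs, ele, hx, hy, K_arrow_right hy hx]
    · simp [inputs, outputs, ele, hx, hy]

theorem outputs_arrow {x y : HType} (h : Disjoint x.ele y.ele) :
    (arrow x y).outputs = x.inputs ∪ y.outputs := by
  rw [outputs, inputs_arrow h, ele]
  ext A
  have h1 : A ∈ x.ele ↔ A ∈ x.inputs ∨ A ∈ x.outputs := by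
    rw [← x.inputs_union_outputs, mem_union]
  have h2 : A ∈ x.inputs → A ∉ x.outputs := fun h => disjoint_left.1 x.disjoint_inputs_outputs h
  have h3 : A ∈ y.inputs → A ∈ y.ele := fun h => y.inputs_subset_ele h
  have h4 : A ∈ y.outputs ↔ A ∈ y.ele ∧ A ∉ y.inputs := mem_sdiff
  have h5 : A ∈ x.ele → A ∉ y.ele := fun h1 h2 => disjoint_left.1 h h1 h2
  simp only [mem_union, mem_sdiff]
  tauto

theorem ele_ext (x : HType) (E : Finset QSystem) : (x.ext E).ele = x.ele ∪ E := by
  induction x with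
  | elem A => rfl
  | arrow x y _ ih => simp [ext, ele, ih]

theorem NoRepeat.ext {x : HType} (hx : x.NoRepeat) {E : Finset QSystem} (hE : Disjoint E x.ele) :
    (x.ext E).NoRepeat := by
  induction x with
  | elem A => trivial
  | arrow x y _ ih =>
    have hE' := disjoint_union_right.1 hE
    refine ⟨hx.1, ih hx.2.1 hE'.2, ?_⟩
    rw [ele_ext]
    exact disjoint_union_right.2 ⟨hx.2.2, hE'.1.symm⟩

theorem inputs_ext {x : HType} (hx : x.NoRepeat) {E : Finset QSystem} (hE : Disjoint E x.ele) :
    (x.ext E).inputs = x.inputs := by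
  induction x with
  | elem A => simp [HType.ext, inputs_elem]
  | arrow x y _ ih =>
    have hE' := disjoint_union_right.1 hE
    have := (hx.ext hE).2.2
    rw [HType.ext, inputs_arrow this, inputs_arrow hx.2.2, ih hx.2.1 hE'.2]

theorem outputs_ext {x : HType} (hx : x.NoRepeat) {E : Finset QSystem} (hE : Disjoint E x.ele) :
    (x.ext E).outputs = x.outputs ∪ E := by
  rw [outputs, inputs_ext hx hE, ele_ext, outputs, union_sdiff_distrib]
  congr 1
  exact sdiff_eq_self_of_disjoint (hE.mono_right x.inputs_subset_ele)

end HType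

/-! ### Operators as functions of global configurations -/

/-- A choice of a basis label for every system. -/
abbrev GConf : Type := (A : QSystem) → Fin A.dim

theorem QSystem.dim_pos (A : QSystem) : 0 < A.dim := lt_of_lt_of_le two_pos A.two_le_dim

instance (A : QSystem) : NeZero A.dim := ⟨A.dim_pos.ne'⟩

/-- The restriction of a global configuration to the systems of `S`. -/
def restr (S : Finset QSystem) (g : GConf) : Conf S := fun i => g i.1

/-- The global configuration that agrees with `s` on `U` and with `g` elsewhere. -/
def upd {U : Finset QSystem} (g : GConf) (s : Conf U) : GConf :=
  fun i => if hi : i ∈ U then s ⟨i, hi⟩ else g i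

/-- Two global configurations agree on `S`. -/
def Agree (S : Finset QSystem) (g h : GConf) : Prop := ∀ i ∈ S, g i = h i

/-- An operator as a kernel on global configurations. -/
def lift {S : Finset QSystem} (M : Op S) (g g' : GConf) : ℂ := M (restr S g) (restr S g')

/-- The kernel depends on the labels of the systems in `S` only. -/
def DepOn (S : Finset QSystem) (F : GConf → GConf → ℂ) : Prop :=
  ∀ g g' h h', Agree S g h → Agree S g' h' → F g g' = F h h'

/-- The operator on `S` given by a kernel. -/
def low (S : Finset QSystem) (F : GConf → GConf → ℂ) : Op S :=
  Matrix.of fun c c' => F (upd (fun _ => 0) c) (upd (fun _ => 0) c')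

/-- The link product of kernels that share the systems of `U`. -/
noncomputable def glink (U : Finset QSystem) (P Q : GConf → GConf → ℂ) (g g' : GConf) : ℂ :=
  ∑ s : Conf U, ∑ s' : Conf U, P (upd g s) (upd g' s') * Q (upd g s) (upd g' s')

/-- Equality of the labels on `S`, as a number. -/
noncomputable def delta (S : Finset QSystem) (g g' : GConf) : ℂ :=
  open Classical in if Agree S g g' then 1 else 0

/-- Positivity of a kernel, by a Gram decomposition. -/
def Pos (F : GConf → GConf → ℂ) : Prop :=
  ∃ (n : ℕ) (v : Fin n → GConf → ℂ), ∀ g g', F g g' = ∑ k, v k g * star (v k g')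

theorem upd_of_mem {U : Finset QSystem} (g : GConf) (s : Conf U) {i : QSystem} (hi : i ∈ U) :
    upd g s i = s ⟨i, hi⟩ := dif_pos hi

theorem upd_of_notMem {U : Finset QSystem} (g : GConf) (s : Conf U) {i : QSystem} (hi : i ∉ U) :
    upd g s i = g i := dif_neg hi

@[simp] theorem restr_upd {U : Finset QSystem} (g : GConf) (s : Conf U) : restr U (upd g s) = s :=
  funext fun i => upd_of_mem g s i.2

@[simp] theorem upd_restr (U : Finset QSystem) (g : GConf) : upd g (restr U g) = g := by
  funext i
  by_cases hi : i ∈ U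
  · rw [upd_of_mem _ _ hi]; rfl
  · rw [upd_of_notMem _ _ hi]

theorem restr_eq_iff {S : Finset QSystem} {g h : GConf} : restr S g = restr S h ↔ Agree S g h :=
  ⟨fun e i hi => congrFun e ⟨i, hi⟩, fun e => funext fun i => e i.1 i.2⟩

theorem Agree.symm {S : Finset QSystem} {g h : GConf} (e : Agree S g h) : Agree S h g :=
  fun i hi => (e i hi).symm

theorem Agree.trans {S : Finset QSystem} {g h k : GConf} (e : Agree S g h) (e' : Agree S h k) :
    Agree S g k := fun i hi => (e i hi).trans (e' i hi)

theorem Agree.mono {S T : Finset QSystem} (hST : S ⊆ T) {g h : GConf} (e : Agree T g h) :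
    Agree S g h := fun i hi => e i (hST hi)

theorem Agree.rfl {S : Finset QSystem} {g : GConf} : Agree S g g := fun _ _ => Eq.refl _

theorem agree_union {S T : Finset QSystem} {g h : GConf} :
    Agree (S ∪ T) g h ↔ Agree S g h ∧ Agree T g h :=
  ⟨fun e => ⟨e.mono subset_union_left, e.mono subset_union_right⟩,
    fun e i hi => (mem_union.1 hi).elim (e.1 i) (e.2 i)⟩

theorem Agree.upd {S U : Finset QSystem} {g h : GConf} (e : Agree (S \ U) g h) (s : Conf U) :
    Agree S (upd g s) (upd h s) := by
  intro i hi
  by_cases hU : i ∈ U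
  · simp [upd_of_mem _ _ hU]
  · simpa [upd_of_notMem _ _ hU] using e i (by simp [hi, hU])

theorem agree_upd_self {S U : Finset QSystem} (h : Disjoint S U) (g : GConf) (s : Conf U) :
    Agree S (_root_.upd g s) g := fun _ hi => upd_of_notMem _ _ (disjoint_left.1 h hi)

theorem agree_upd_upd_iff {U : Finset QSystem} {g h : GConf} {s t : Conf U} :
    Agree U (_root_.upd g s) (_root_.upd h t) ↔ s = t := by
  rw [← restr_eq_iff, restr_upd, restr_upd]

theorem DepOn.mono {S T : Finset QSystem} (hST : S ⊆ T) {F : GConf → GConf → ℂ} (hF : DepOn S F) :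
    DepOn T F := fun _ _ _ _ e e' => hF _ _ _ _ (e.mono hST) (e'.mono hST)

theorem depOn_lift {S : Finset QSystem} (M : Op S) : DepOn S (lift M) := by
  intro g g' h h' e e'
  rw [lift, lift, restr_eq_iff.2 e, restr_eq_iff.2 e']

/-- The base label 0 used to extend a configuration is harmless, because the kernel sees only the
systems of S. -/
theorem lift_low {S : Finset QSystem} {F : GConf → GConf → ℂ} (hF : DepOn S F) :
    lift (low S F) = F := by
  funext g g'
  exact hF _ _ _ _ (restr_eq_iff.1 (restr_upd _ _)) (restr_eq_iff.1 (restr_upd _ _))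

theorem low_lift {S : Finset QSystem} (M : Op S) : low S (lift M) = M := by
  ext c c'
  simp [low, lift]

theorem lift_injective {S : Finset QSystem} {M N : Op S} (h : lift M = lift N) : M = N := by
  rw [← low_lift M, h, low_lift]

theorem restr_glue {S T U : Finset QSystem} (h : S ⊆ T ∪ U) (g : GConf) (s : Conf U) :
    glue h (restr T g) s = restr S (upd g s) := by
  funext i
  by_cases hi : i.1 ∈ U <;> simp [glue, restr, upd, hi]

theorem upd_glue {S T U : Finset QSystem} (h : S = T ∪ U) (g : GConf) (t : Conf T) (u : Conf U) :
    upd g (glue h.subset t u) = upd (upd g t) u := by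
  funext i
  have : i ∈ S ↔ i ∈ T ∨ i ∈ U := by rw [h, mem_union]
  by_cases hU : i ∈ U <;> by_cases hT : i ∈ T <;> simp [glue, upd, hU, hT, this]

theorem upd_comm {T U : Finset QSystem} (h : Disjoint T U) (g : GConf) (t : Conf T) (u : Conf U) :
    upd (upd g t) u = upd (upd g u) t := by
  funext i
  by_cases hU : i ∈ U
  · have hT : i ∉ T := disjoint_right.1 h hU
    simp [upd, hU, hT]
  · simp [upd, hU]

/-- The purpose of kernels on global configurations: operators on `Y ∪ E` and on the literal index
set of `link` live in different Lean types, while their kernels live in one. -/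
theorem lift_link {S T : Finset QSystem} (P : Op S) (Q : Op T) :
    lift (link P Q) = glink (S ∩ T) (lift P) (lift Q) := by
  funext g g'
  simp only [lift, link, glink, Matrix.of_apply, restr_glue]

theorem lift_add {S : Finset QSystem} (M N : Op S) : lift (M + N) = lift M + lift N := rfl

theorem lift_sub {S : Finset QSystem} (M N : Op S) : lift (M - N) = lift M - lift N := rfl

theorem lift_sum {S : Finset QSystem} {ι : Type*} (s : Finset ι) (M : ι → Op S) :
    lift (∑ i ∈ s, M i) = ∑ i ∈ s, lift (M i) := by
  funext g g'
  simp [lift, Matrix.sum_apply, Finset.sum_apply]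

/-- Summation over the labels of a disjoint union of systems. -/
theorem sum_conf_union {T U S : Finset QSystem} (h : S = T ∪ U) (hd : Disjoint T U)
    (f : Conf S → ℂ) : ∑ s, f s = ∑ t : Conf T, ∑ u : Conf U, f (glue h.subset t u) := by
  rw [← Fintype.sum_prod_type' (f := fun t u => f (glue h.subset t u))]
  symm
  refine Fintype.sum_equiv
    { toFun := fun p => glue h.subset p.1 p.2
      invFun := fun s => ((fun i : T => s ⟨i.1, by rw [h]; exact mem_union_left _ i.2⟩),
        (fun i : U => s ⟨i.1, by rw [h]; exact mem_union_right _ i.2⟩))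
      left_inv := ?_
      right_inv := ?_ } _ _ (fun _ => rfl)
  · rintro ⟨t, u⟩
    refine Prod.ext (funext fun i => ?_) (funext fun i => ?_)
    · simp [glue, disjoint_left.1 hd i.2]
    · simp [glue]
  · intro s
    funext i
    by_cases hi : i.1 ∈ U <;> simp [glue, hi]

theorem delta_of_agree {S : Finset QSystem} {g g' : GConf} (h : Agree S g g') : delta S g g' = 1 :=
  if_pos h

theorem delta_of_not_agree {S : Finset QSystem} {g g' : GConf} (h : ¬ Agree S g g') :
    delta S g g' = 0 := if_neg h

theorem delta_upd_upd {U : Finset QSystem} (g g' : GConf) (s t : Conf U) :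
    delta U (upd g s) (upd g' t) = if s = t then 1 else 0 := by
  classical
  simp only [delta, agree_upd_upd_iff]

theorem delta_union (S T : Finset QSystem) (g g' : GConf) :
    delta (S ∪ T) g g' = delta S g g' * delta T g g' := by
  by_cases hS : Agree S g g' <;> by_cases hT : Agree T g g' <;>
    simp [delta, agree_union, hS, hT]

theorem delta_congr {S : Finset QSystem} {g g' h h' : GConf} (e : Agree S g h)
    (e' : Agree S g' h') : delta S g g' = delta S h h' := by
  have : Agree S g g' ↔ Agree S h h' :=
    ⟨fun k => (e.symm.trans k).trans e', fun k => (e.trans k).trans e'.symm⟩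
  unfold delta
  by_cases hk : Agree S h h'
  · rw [if_pos hk, if_pos (this.2 hk)]
  · rw [if_neg hk, if_neg fun h => hk (this.1 h)]

/-! ### Positive kernels -/

theorem pos_of_fintype {ι : Type*} [Fintype ι] {F : GConf → GConf → ℂ} (v : ι → GConf → ℂ)
    (h : ∀ g g', F g g' = ∑ k, v k g * star (v k g')) : Pos F := by
  refine ⟨Fintype.card ι, fun k => v ((Fintype.equivFin ι).symm k), fun g g' => ?_⟩
  rw [h]
  exact (Fintype.sum_equiv (Fintype.equivFin ι).symm _ _ fun _ => rfl).symm

theorem pos_lift_iff {S : Finset QSystem} (M : Op S) : Pos (lift M) ↔ M.PosSemidef := by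
  rw [Matrix.posSemidef_iff_eq_sum_vecMulVec]
  constructor
  · rintro ⟨n, v, h⟩
    refine ⟨n, fun k c => v k (upd (fun _ => 0) c), ?_⟩
    rw [← low_lift M]
    ext c c'
    simp [low, h, Matrix.sum_apply, Matrix.vecMulVec_apply]
  · rintro ⟨n, v, h⟩
    refine ⟨n, fun k g => v k (restr S g), fun g g' => ?_⟩
    simp [lift, h, Matrix.sum_apply, Matrix.vecMulVec_apply]

theorem Pos.add {F G : GConf → GConf → ℂ} (hF : Pos F) (hG : Pos G) : Pos (F + G) := by
  obtain ⟨m, v, hv⟩ := hF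
  obtain ⟨n, w, hw⟩ := hG
  exact pos_of_fintype (Sum.elim v w) fun g g' => by simp [hv, hw]

theorem pos_zero : Pos 0 := ⟨0, fun _ _ => 0, fun _ _ => by simp⟩

theorem Pos.sum {ι : Type*} (s : Finset ι) {F : ι → GConf → GConf → ℂ} (hF : ∀ i ∈ s, Pos (F i)) :
    Pos (∑ i ∈ s, F i) :=
  Finset.sum_induction _ Pos (fun _ _ => Pos.add) pos_zero hF

theorem Pos.smul {F : GConf → GConf → ℂ} (hF : Pos F) {r : ℝ} (hr : 0 ≤ r) :
    Pos ((r : ℂ) • F) := by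
  obtain ⟨m, v, hv⟩ := hF
  refine ⟨m, fun k g => (Real.sqrt r : ℂ) * v k g, fun g g' => ?_⟩
  have h : ((Real.sqrt r : ℝ) : ℂ) * (Real.sqrt r : ℝ) = r := by
    rw [← Complex.ofReal_mul, Real.mul_self_sqrt hr]
  simp only [Pi.smul_apply, smul_eq_mul, hv, Finset.mul_sum, ← h]
  refine Finset.sum_congr rfl fun k _ => ?_
  simp only [star_mul', Complex.star_def, Complex.conj_ofReal]
  ring

theorem Pos.comp {F : GConf → GConf → ℂ} (hF : Pos F) (φ : GConf → GConf) :
    Pos fun g g' => F (φ g) (φ g') := by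
  obtain ⟨m, v, hv⟩ := hF
  exact ⟨m, fun k g => v k (φ g), fun g g' => hv _ _⟩

/-- In coordinates the link product carries no transposition. Products of Gram vectors, summed over
the shared labels, are therefore Gram vectors of the result. -/
theorem Pos.glink {F G : GConf → GConf → ℂ} (hF : Pos F) (hG : Pos G) (U : Finset QSystem) :
    Pos (glink U F G) := by
  obtain ⟨m, v, hv⟩ := hF
  obtain ⟨n, w, hw⟩ := hG
  refine pos_of_fintype (ι := Fin m × Fin n)
    (fun k g => ∑ s : Conf U, v k.1 (upd g s) * w k.2 (upd g s)) fun g g' => ?_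
  simp only [_root_.glink, hv, hw, Fintype.sum_prod_type, star_sum, Finset.sum_mul_sum, star_mul']
  rw [Finset.sum_congr rfl fun s _ => Finset.sum_comm, Finset.sum_comm]
  refine Finset.sum_congr rfl fun i _ => ?_
  rw [Finset.sum_congr rfl fun s _ => Finset.sum_comm, Finset.sum_comm]
  refine Finset.sum_congr rfl fun j _ => Finset.sum_congr rfl fun s _ =>
    Finset.sum_congr rfl fun s' _ => ?_
  ring

theorem Pos.diag_nonneg {F : GConf → GConf → ℂ} (hF : Pos F) (g : GConf) : 0 ≤ F g g := by
  obtain ⟨m, v, hv⟩ := hF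
  rw [hv]
  exact Finset.sum_nonneg fun k _ => mul_star_self_nonneg _

theorem glink_depOn {U S T W : Finset QSystem} {P Q : GConf → GConf → ℂ} (hP : DepOn S P)
    (hQ : DepOn T Q) (h : (S ∪ T) \ U ⊆ W) : DepOn W (glink U P Q) := by
  intro g g' k k' e e'
  have e := e.mono h
  have e' := e'.mono h
  simp only [glink]
  refine Finset.sum_congr rfl fun s _ => Finset.sum_congr rfl fun s' _ => ?_
  have a := agree_union.1 (e.upd s)
  have a' := agree_union.1 (e'.upd s')
  rw [hP _ _ _ _ a.1 a'.1, hQ _ _ _ _ a.2 a'.2]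

theorem glink_add_left (U : Finset QSystem) (P P' Q : GConf → GConf → ℂ) :
    glink U (P + P') Q = glink U P Q + glink U P' Q := by
  funext g g'
  simp [glink, add_mul, Finset.sum_add_distrib]

theorem glink_add_right (U : Finset QSystem) (P Q Q' : GConf → GConf → ℂ) :
    glink U P (Q + Q') = glink U P Q + glink U P Q' := by
  funext g g'
  simp [glink, mul_add, Finset.sum_add_distrib]

theorem glink_smul_right (U : Finset QSystem) (P Q : GConf → GConf → ℂ) (c : ℂ) :
    glink U P (c • Q) = c • glink U P Q := by
  funext g g'
  simp [glink, Finset.mul_sum, mul_left_comm]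

/-! ### Duality between channels and states tensored with the identity -/

/-! ### States on the outputs, tensored with the identity on the inputs -/

/-- The kernel is that of `σ ⊗ 1`, where `σ` has unit trace on `O` and `1` is the identity on `I`. -/
structure IsStateOn (I O : Finset QSystem) (F : GConf → GConf → ℂ) : Prop where
  eq_zero : ∀ g g', ¬ Agree I g g' → F g g' = 0
  congr : ∀ g g' h h', Agree I g g' → Agree I h h' → Agree O g h → Agree O g' h' → F g g' = F h h'
  sum_eq : ∀ g, ∑ s : Conf O, F (upd g s) (upd g s) = 1

theorem IsStateOn.depOn {I O : Finset QSystem} {F : GConf → GConf → ℂ} (hF : IsStateOn I O F) :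
    DepOn (I ∪ O) F := by
  intro g g' h h' e e'
  rw [agree_union] at e e'
  by_cases hI : Agree I g g'
  · exact hF.congr _ _ _ _ hI ((e.1.symm.trans hI).trans e'.1) e.2 e'.2
  · rw [hF.eq_zero _ _ hI, hF.eq_zero]
    exact fun hh => hI ((e.1.trans hh).trans e'.1.symm)

/-- A channel from `I` to `O`. -/
def IsChannel (I O : Finset QSystem) (F : GConf → GConf → ℂ) : Prop :=
  ∀ g g', ∑ s : Conf O, F (upd g s) (upd g' s) = delta I g g'

theorem sum_upd_union {T U S : Finset QSystem} (h : S = T ∪ U) (hd : Disjoint T U)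
    (f : GConf → GConf → ℂ) (g g' : GConf) :
    ∑ s : Conf S, f (upd g s) (upd g' s) =
      ∑ t : Conf T, ∑ u : Conf U, f (upd (upd g t) u) (upd (upd g' t) u) := by
  rw [sum_conf_union h hd]
  simp only [upd_glue h]

/-- Write F = `σ ⊗ 1` with σ a state on `Ix ∪ Oy`. Linking feeds the Ix part of σ into the channel ρ
and discards Ox, which leaves a state on `Oy ∪ E`; Iy is untouched and keeps its identity. -/
theorem IsStateOn.glink {Ix Ox Iy Oy E : Finset QSystem} (hX : Disjoint Ix Ox)
    (hXY : Disjoint (Ix ∪ Ox) (Iy ∪ Oy)) (hE : Disjoint E ((Ix ∪ Ox) ∪ (Iy ∪ Oy)))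
    {ρ F : GConf → GConf → ℂ} (hF : IsStateOn (Ox ∪ Iy) (Ix ∪ Oy) F)
    (hρ : DepOn (Ix ∪ Ox ∪ E) ρ) (hρ' : IsChannel Ix (Ox ∪ E) ρ) :
    IsStateOn Iy (Oy ∪ E) (glink (Ix ∪ Ox) ρ F) := by
  simp only [disjoint_union_left, disjoint_union_right] at hXY hE
  obtain ⟨⟨d1, d2⟩, d3, d4⟩ := hXY
  obtain ⟨⟨d5, d6⟩, d7, d8⟩ := hE
  refine ⟨fun g g' h => ?_, fun g g' h h' e1 e2 e3 e4 => ?_, fun g => ?_⟩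
  · refine Finset.sum_eq_zero fun s _ => Finset.sum_eq_zero fun s' _ => ?_
    rw [hF.eq_zero, mul_zero]
    intro k
    apply h
    have := (agree_union.1 k).2
    have dd : Disjoint Iy (Ix ∪ Ox) := disjoint_union_right.2 ⟨d1.symm, d2.symm⟩
    exact ((agree_upd_self dd _ _).symm.trans this).trans (agree_upd_self dd _ _)
  · refine Finset.sum_congr rfl fun s _ => Finset.sum_congr rfl fun s' _ => ?_
    have hr : ρ (upd g s) (upd g' s') = ρ (upd h s) (upd h' s') := by
      apply hρ
      · refine Agree.upd (fun i hi => ?_) _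
        refine e3 i ?_
        simp only [mem_sdiff, mem_union] at hi ⊢
        tauto
      · refine Agree.upd (fun i hi => ?_) _
        refine e4 i ?_
        simp only [mem_sdiff, mem_union] at hi ⊢
        tauto
    rw [hr]
    congr 1
    have dd : Disjoint Iy (Ix ∪ Ox) := disjoint_union_right.2 ⟨d1.symm, d2.symm⟩
    have aux : ∀ k k' : GConf, Agree Iy k k' →
        (Agree (Ox ∪ Iy) (upd k s) (upd k' s') ↔ restr Ox (upd k s) = restr Ox (upd k' s')) := by
      intro k k' e
      rw [agree_union, restr_eq_iff, and_iff_left]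
      exact ((agree_upd_self dd _ _).trans e).trans (agree_upd_self dd _ _).symm
    have cst : ∀ k h : GConf, ∀ s : Conf (Ix ∪ Ox), restr Ox (upd k s) = restr Ox (upd h s) := by
      intro k h s
      rw [restr_eq_iff]
      exact (agree_upd_upd_iff.2 rfl : Agree (Ix ∪ Ox) _ _).mono subset_union_right
    have hiff : Agree (Ox ∪ Iy) (upd g s) (upd g' s') ↔ Agree (Ox ∪ Iy) (upd h s) (upd h' s') := by
      rw [aux _ _ e1, aux _ _ e2, cst g h, cst g' h']
    by_cases hag : Agree (Ox ∪ Iy) (upd g s) (upd g' s')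
    · apply hF.congr _ _ _ _ hag (hiff.1 hag)
      · refine Agree.upd (fun i hi => e3 i ?_) _
        simp only [mem_sdiff, mem_union] at hi ⊢
        tauto
      · refine Agree.upd (fun i hi => e4 i ?_) _
        simp only [mem_sdiff, mem_union] at hi ⊢
        tauto
    · rw [hF.eq_zero _ _ hag, hF.eq_zero _ _ fun k => hag (hiff.2 k)]
  -- For the trace: the identity on Ox in F forces `a = a'`, after which F no longer depends on a or
  -- e, and ρ does not depend on o. The sum of ρ over a and e is then the identity on Ix, which
  -- leaves the trace of σ.
  · have key : ∀ (o : Conf Oy) (e : Conf E) (b : Conf Ix) (a : Conf Ox) (b' : Conf Ix)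
        (a' : Conf Ox),
        ρ (upd (upd (upd (upd g o) e) b) a) (upd (upd (upd (upd g o) e) b') a') *
          F (upd (upd (upd (upd g o) e) b) a) (upd (upd (upd (upd g o) e) b') a') =
        if a = a' then ρ (upd (upd (upd g b) a) e) (upd (upd (upd g b') a) e) *
          F (upd (upd g b) o) (upd (upd g b') o) else 0 := by
      intro o e b a b' a'
      split_ifs with haa
      · subst haa
        congr 1
        · have : ∀ b : Conf Ix, Agree (Ix ∪ Ox ∪ E) (upd (upd (upd (upd g o) e) b) a)
              (upd (upd (upd g b) a) e) := by
            intro b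
            rw [upd_comm d5 _ e b, upd_comm d6 _ e a, upd_comm d3.symm _ o b,
              upd_comm d4.symm _ o a]
            refine Agree.upd ?_ _
            refine (agree_upd_self ?_ _ _)
            exact (disjoint_union_left.2 ⟨disjoint_union_left.2 ⟨d3, d4⟩, d8⟩).mono_left sdiff_subset
          exact hρ _ _ _ _ (this b) (this b')
        · have h1 : ∀ b : Conf Ix, Agree (Ix ∪ Oy) (upd (upd (upd (upd g o) e) b) a)
              (upd (upd g b) o) := by
            intro b
            refine (agree_upd_self (disjoint_union_left.2 ⟨hX, d4.symm⟩) _ _).trans ?_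
            rw [upd_comm d3 g b o]
            refine Agree.upd ?_ _
            exact agree_upd_self ((disjoint_union_left.2 ⟨d5.symm, d8.symm⟩).mono_left sdiff_subset) _ _
          apply hF.congr _ _ _ _ _ _ (h1 b) (h1 b')
          · refine Agree.upd ?_ _
            refine ((agree_upd_self ?_ _ _).trans (agree_upd_self ?_ _ _).symm)
            all_goals exact (disjoint_left.2 fun i hi hi' => by
              simp only [mem_sdiff, mem_union] at hi
              rcases hi.1 with h | h
              · exact hi.2 h
              · exact disjoint_left.1 d1 hi' h)
          · rw [← upd_comm d3.symm, ← upd_comm d3.symm]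
            refine ((agree_upd_self ?_ _ _).trans (agree_upd_self ?_ _ _).symm)
            all_goals exact disjoint_union_left.2 ⟨hX.symm, d1.symm⟩
      · rw [hF.eq_zero, mul_zero]
        intro k
        exact haa (agree_upd_upd_iff.1 (agree_union.1 k).1)
    have hch : ∀ b b' : Conf Ix, ∑ a : Conf Ox, ∑ e : Conf E,
        ρ (upd (upd (upd g b) a) e) (upd (upd (upd g b') a) e) = if b = b' then 1 else 0 := by
      intro b b'
      rw [← sum_upd_union rfl d6.symm, hρ', delta_upd_upd]
    calc ∑ t : Conf (Oy ∪ E), _root_.glink (Ix ∪ Ox) ρ F (upd g t) (upd g t)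
        = ∑ o : Conf Oy, ∑ e : Conf E, ∑ b : Conf Ix, ∑ a : Conf Ox, ∑ b' : Conf Ix,
            ∑ a' : Conf Ox, (if a = a' then ρ (upd (upd (upd g b) a) e) (upd (upd (upd g b') a) e) *
          F (upd (upd g b) o) (upd (upd g b') o) else 0) := by
          rw [sum_upd_union rfl d8.symm]
          refine Finset.sum_congr rfl fun o _ => Finset.sum_congr rfl fun e _ => ?_
          rw [_root_.glink, sum_conf_union rfl hX]
          refine Finset.sum_congr rfl fun b _ => Finset.sum_congr rfl fun a _ => ?_
          rw [sum_conf_union rfl hX]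
          refine Finset.sum_congr rfl fun b' _ => Finset.sum_congr rfl fun a' _ => ?_
          rw [upd_glue rfl, upd_glue rfl, key]
      _ = ∑ o : Conf Oy, ∑ b : Conf Ix, ∑ b' : Conf Ix, (∑ a : Conf Ox, ∑ e : Conf E,
            ρ (upd (upd (upd g b) a) e) (upd (upd (upd g b') a) e)) *
          F (upd (upd g b) o) (upd (upd g b') o) := by
          refine Finset.sum_congr rfl fun o _ => ?_
          rw [Finset.sum_comm]
          refine Finset.sum_congr rfl fun b _ => ?_
          simp only [Finset.sum_ite_eq, Finset.mem_univ, if_true, Finset.sum_mul]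
          rw [Finset.sum_comm, Finset.sum_congr rfl fun a _ => Finset.sum_comm, Finset.sum_comm]
      _ = ∑ b : Conf Ix, ∑ o : Conf Oy, F (upd (upd g b) o) (upd (upd g b) o) := by
          simp only [hch, ite_mul, one_mul, zero_mul, Finset.sum_ite_eq, Finset.mem_univ, if_true]
          rw [Finset.sum_comm]
      _ = 1 := by rw [← sum_upd_union rfl d3, hF.sum_eq]

/-- The state `|w⟩⟨w|` on `O`, tensored with the identity on `I`. -/
noncomputable def pureOn (I : Finset QSystem) (w : GConf → ℂ) (g g' : GConf) : ℂ :=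
  delta I g g' * (w g * star (w g'))

theorem pureOn_pos (I : Finset QSystem) (w : GConf → ℂ) : Pos (pureOn I w) := by
  refine pos_of_fintype (ι := Conf I) (fun k g => (if k = restr I g then 1 else 0) * w g)
    fun g g' => ?_
  simp only [star_mul', pureOn]
  rw [Finset.sum_eq_single (restr I g)]
  · by_cases h : restr I g = restr I g'
    · simp [h, delta_of_agree (restr_eq_iff.1 h)]
    · simp [h, delta_of_not_agree fun k => h (restr_eq_iff.2 k)]
  · intro k _ hk
    simp [hk]
  · simp

theorem pureOn_isStateOn {I O : Finset QSystem} {w : GConf → ℂ}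
    (hw : ∀ g h, Agree O g h → w g = w h)
    (h1 : ∀ g, ∑ s : Conf O, w (upd g s) * star (w (upd g s)) = 1) :
    IsStateOn I O (pureOn I w) := by
  refine ⟨fun g g' h => ?_, fun g g' h h' e1 e2 e3 e4 => ?_, fun g => ?_⟩
  · rw [pureOn, delta_of_not_agree h, zero_mul]
  · rw [pureOn, pureOn, delta_of_agree e1, delta_of_agree e2, hw _ _ e3, hw _ _ e4]
  · simp only [pureOn, delta_of_agree Agree.rfl, one_mul, h1]

theorem card_conf_ne_zero (S : Finset QSystem) : (Fintype.card (Conf S) : ℂ) ≠ 0 :=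
  Nat.cast_ne_zero.2 Fintype.card_ne_zero

/-- The maximally mixed state on `O`, tensored with the identity on `I`. -/
theorem mixed_isStateOn (I O : Finset QSystem) :
    IsStateOn I O fun g g' => ((Fintype.card (Conf O) : ℂ)⁻¹) * delta (I ∪ O) g g' := by
  refine ⟨fun g g' h => ?_, fun g g' h h' e1 e2 e3 e4 => ?_, fun g => ?_⟩
  · simp [delta_union, delta_of_not_agree h]
  · simp only [delta_union, delta_of_agree e1, delta_of_agree e2, delta_congr e3 e4]
  · simp only [delta_of_agree Agree.rfl, Finset.sum_const, Finset.card_univ, nsmul_eq_mul, mul_one]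
    exact mul_inv_cancel₀ (card_conf_ne_zero O)

/-- Polarization: a sesquilinear form that is constant on the unit sphere is a multiple of the inner
product. -/
theorem eq_ite_of_forall_unit {ι : Type*} [Fintype ι] [DecidableEq ι] {N : ι → ι → ℂ} {c : ℂ}
    (h : ∀ w : ι → ℂ, ∑ a, w a * star (w a) = 1 → ∑ a, ∑ b, w a * star (w b) * N a b = c)
    (a b : ι) : N a b = if a = b then c else 0 := by
  have diag : ∀ a, N a a = c := by
    intro a
    have := h (fun i => if i = a then 1 else 0) (by simp)
    simpa using this
  split_ifs with hab
  · rw [← hab, diag]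
  · have key : ∀ ω : ℂ, ω * star ω = 1 → star ω * N a b + ω * N b a = 0 := by
      intro ω hω
      have e : ∀ f : ι → ℂ, (∀ i, i ≠ a ∧ i ≠ b → f i = 0) → ∑ i, f i = f a + f b :=
        fun f hf => Fintype.sum_eq_add a b hab hf
      have hb : b ≠ a := Ne.symm hab
      -- A unit vector with rational coefficients, from the triple (3, 4, 5). The diagonal terms
      -- already add up to c, so the cross terms cancel; the phases 1 and i then separate `N a b`
      -- from `N b a`.
      have := h (fun i => if i = a then 3 / 5 else if i = b then 4 / 5 * ω else 0) (by
        rw [e _ fun i hi => by simp [hi.1, hi.2]]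
        simp only [if_true, hb, if_false, star_mul']
        simp only [Complex.star_def, map_div₀, map_ofNat] at hω ⊢
        linear_combination (16 / 25) * hω)
      rw [e _ fun i hi => by simp [hi.1, hi.2], e _ fun i hi => by simp [hi.1, hi.2],
        e _ fun i hi => by simp [hi.1, hi.2]] at this
      simp only [if_true, hb, if_false, star_mul', diag] at this
      simp only [Complex.star_def, map_div₀, map_ofNat] at hω this ⊢
      linear_combination (25 / 12) * this - (4 / 3) * c * hω
    have h1 := key 1 (by simp)
    have h2 := key Complex.I (by simp)
    simp only [star_one, one_mul, Complex.star_def, Complex.conj_I] at h1 h2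
    have h3 : Complex.I * (N b a - N a b) = 0 := by linear_combination h2
    have h4 := (mul_eq_zero.1 h3).resolve_left Complex.I_ne_zero
    linear_combination (1 / 2) * h1 - (1 / 2) * h4

/-- A kernel that maps every pure state on `Ox` to a channel is itself a channel. -/
theorem isChannel_of_glink_pureOn {Ix Ox Iy Oy : Finset QSystem} (hX : Disjoint Ix Ox)
    (hXY : Disjoint (Ix ∪ Ox) (Iy ∪ Oy)) {F : GConf → GConf → ℂ}
    (h : ∀ w : GConf → ℂ, (∀ g h, Agree Ox g h → w g = w h) →
      (∀ g, ∑ s : Conf Ox, w (upd g s) * star (w (upd g s)) = 1) →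
      IsChannel Iy Oy (glink (Ix ∪ Ox) (pureOn Ix w) F)) :
    IsChannel (Ox ∪ Iy) (Ix ∪ Oy) F := by
  simp only [disjoint_union_left, disjoint_union_right] at hXY
  obtain ⟨⟨d1, d2⟩, d3, d4⟩ := hXY
  intro g g'
  have key := eq_ite_of_forall_unit (ι := Conf Ox) (c := delta Iy g g')
    (N := fun a a' => ∑ o : Conf Oy, ∑ b : Conf Ix,
      F (upd (upd (upd g o) b) a) (upd (upd (upd g' o) b) a')) (by
    intro v hv
    rw [← h (fun g => v (restr Ox g)) (fun g h e => by rw [restr_eq_iff.2 e])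
      (fun g => by simpa using hv) g g']
    symm
    calc ∑ o : Conf Oy, glink (Ix ∪ Ox) (pureOn Ix fun g => v (restr Ox g)) F (upd g o) (upd g' o)
        = ∑ o : Conf Oy, ∑ b : Conf Ix, ∑ a : Conf Ox, ∑ b' : Conf Ix, ∑ a' : Conf Ox,
            (if b = b' then 1 else 0) * (v a * star (v a')) *
            F (upd (upd (upd g o) b) a) (upd (upd (upd g' o) b') a') := by
          refine Finset.sum_congr rfl fun o _ => ?_
          rw [glink, sum_conf_union rfl hX]
          refine Finset.sum_congr rfl fun b _ => Finset.sum_congr rfl fun a _ => ?_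
          rw [sum_conf_union rfl hX]
          refine Finset.sum_congr rfl fun b' _ => Finset.sum_congr rfl fun a' _ => ?_
          rw [upd_glue rfl, upd_glue rfl, pureOn, restr_upd, restr_upd, ← delta_upd_upd
            (upd g o) (upd g' o), delta_congr (agree_upd_self hX _ _) (agree_upd_self hX _ _)]
      _ = ∑ o : Conf Oy, ∑ b : Conf Ix, ∑ a : Conf Ox, ∑ a' : Conf Ox, v a * star (v a') *
            F (upd (upd (upd g o) b) a) (upd (upd (upd g' o) b) a') := by
          refine Finset.sum_congr rfl fun o _ => Finset.sum_congr rfl fun b _ =>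
            Finset.sum_congr rfl fun a _ => ?_
          rw [Finset.sum_comm]
          refine Finset.sum_congr rfl fun a' _ => ?_
          simp
      _ = _ := by
          rw [Finset.sum_congr rfl fun o _ => Finset.sum_comm, Finset.sum_comm]
          refine Finset.sum_congr rfl fun a _ => ?_
          rw [Finset.sum_congr rfl fun o _ => Finset.sum_comm, Finset.sum_comm]
          refine Finset.sum_congr rfl fun a' _ => ?_
          simp only [Finset.mul_sum])
  have := key (restr Ox g) (restr Ox g')
  rw [union_comm, sum_upd_union rfl d3.symm, delta_union]
  have hu : ∀ (k : GConf) (o : Conf Oy) (b : Conf Ix),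
      upd (upd (upd k o) b) (restr Ox k) = upd (upd k o) b := by
    intro k o b
    rw [upd_comm hX, upd_comm d4.symm, upd_restr]
  simp only [hu] at this
  rw [this]
  by_cases hag : Agree Ox g g'
  · rw [if_pos (restr_eq_iff.2 hag), delta_of_agree hag, one_mul]
  · rw [if_neg fun k => hag (restr_eq_iff.1 k), delta_of_not_agree hag, zero_mul]

theorem delta_pos (W : Finset QSystem) : Pos (delta W) := by
  have : delta W = pureOn W fun _ => 1 := by
    funext g g'
    simp [pureOn]
  exact this ▸ pureOn_pos W _

/-- With m the squared norm of v, this is the projection onto the complement of v, and the columns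
of a projection are Gram vectors for it. For m = 0 the convention `m⁻¹ = 0` makes it the identity.
-/
theorem pos_delta_sub {W : Finset QSystem} {v : GConf → ℂ} (hv : ∀ g h, Agree W g h → v g = v h)
    {m : ℂ} (hm : m = ∑ s : Conf W, v (upd (fun _ => 0) s) * star (v (upd (fun _ => 0) s))) :
    Pos fun g g' => delta W g g' - m⁻¹ * (v g * star (v g')) := by
  refine pos_of_fintype (ι := Conf W) (fun s g => (if s = restr W g then 1 else 0) -
    m⁻¹ * (v g * star (v (upd (fun _ => 0) s)))) fun g g' => ?_
  have hms : star m = m := by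
    rw [hm, star_sum]
    exact Finset.sum_congr rfl fun s _ => by rw [star_mul', star_star, mul_comm]
  have hg : ∀ g, v (upd (fun _ => 0) (restr W g)) = v g := fun g =>
    hv _ _ (restr_eq_iff.1 (restr_upd _ _))
  have hd : delta W g g' = ∑ s : Conf W, (if s = restr W g then (1 : ℂ) else 0) *
      (if s = restr W g' then 1 else 0) := by
    by_cases h : Agree W g g'
    · simp [delta_of_agree h, restr_eq_iff.2 h]
    · have h' : restr W g' ≠ restr W g := fun k => h (restr_eq_iff.1 k.symm)
      simp [delta_of_not_agree h, h']
  have e : ∀ s : Conf W, ((if s = restr W g then (1 : ℂ) else 0) -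
      m⁻¹ * (v g * star (v (upd (fun _ => 0) s)))) * star ((if s = restr W g' then (1 : ℂ) else 0) -
      m⁻¹ * (v g' * star (v (upd (fun _ => 0) s)))) =
      (if s = restr W g then (1 : ℂ) else 0) * (if s = restr W g' then 1 else 0)
      - (if s = restr W g' then m⁻¹ * (v g * star (v (upd (fun _ => 0) s))) else 0)
      - (if s = restr W g then m⁻¹ * (star (v g') * (v (upd (fun _ => 0) s))) else 0)
      + m⁻¹ * m⁻¹ * (v g * star (v g')) *
        (v (upd (fun _ => 0) s) * star (v (upd (fun _ => 0) s))) := by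
    intro s
    simp only [star_sub, star_mul', star_inv₀, hms, star_star, apply_ite star, star_one, star_zero]
    split_ifs <;> ring
  rw [Finset.sum_congr rfl fun s _ => e s, Finset.sum_add_distrib, Finset.sum_sub_distrib,
    Finset.sum_sub_distrib, ← hd, ← Finset.mul_sum, ← hm]
  simp only [Finset.sum_ite_eq', Finset.mem_univ, if_true, hg]
  by_cases h0 : m = 0
  · simp [h0]
  · field_simp
    ring

/-! ### Types in terms of kernels -/

/-- The kernels of the operators in a family of sets of operators. -/
def Kern (P : ∀ S : Finset QSystem, Op S → Prop) (F : GConf → GConf → ℂ) : Prop :=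
  ∃ (S : Finset QSystem) (M : Op S), P S M ∧ lift M = F

theorem kern_lift_iff {P : ∀ S : Finset QSystem, Op S → Prop} {X : Finset QSystem}
    (hP : ∀ S M, P S M → S = X) {S : Finset QSystem} (hS : S = X) (M : Op S) :
    Kern P (lift M) ↔ P S M := by
  refine ⟨?_, fun h => ⟨S, M, h, rfl⟩⟩
  rintro ⟨T, N, h, e⟩
  obtain rfl : T = S := (hP _ _ h).trans hS.symm
  rwa [← lift_injective e]

theorem Kern.depOn {P : ∀ S : Finset QSystem, Op S → Prop} {X : Finset QSystem}
    (hP : ∀ S M, P S M → S = X) {F : GConf → GConf → ℂ} (h : Kern P F) : DepOn X F := by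
  obtain ⟨S, M, h, rfl⟩ := h
  rw [← hP _ _ h]
  exact depOn_lift M

/-- Complete preservation, for kernels. -/
def KernPreserves (X Y : Finset QSystem) (P Q : Finset QSystem → ∀ S : Finset QSystem, Op S → Prop)
    (F : GConf → GConf → ℂ) : Prop :=
  ∀ E : Finset QSystem, Disjoint E (X ∪ Y) → ∀ ρ, Kern (P E) ρ → Kern (Q E) (glink X ρ F)

/-- Since E is fresh, `X ∪ E` and `X ∪ Y` share exactly X, so the link sums over X and leaves `Y ∪
E`. -/
theorem preserves_iff {X Y : Finset QSystem}
    {P Q : Finset QSystem → ∀ S : Finset QSystem, Op S → Prop}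
    (hP : ∀ E S M, P E S M → S = X ∪ E) (hQ : ∀ E S M, Q E S M → S = Y ∪ E) (hXY : Disjoint X Y)
    {S : Finset QSystem} (hS : S = X ∪ Y) (M : Op S) :
    MapClass.Preserves X Y P Q M ↔ KernPreserves X Y P Q (lift M) := by
  subst hS
  have h1 : ∀ E, Disjoint E (X ∪ Y) → (X ∪ E) ∩ (X ∪ Y) = X := by
    intro E hE
    rw [← union_inter_distrib_left, union_eq_left]
    intro i hi
    exact absurd (mem_union_right X (mem_inter.1 hi).2) (disjoint_left.1 hE (mem_inter.1 hi).1)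
  have h2 : ∀ E, Disjoint E (X ∪ Y) → ((X ∪ E) \ (X ∪ Y)) ∪ ((X ∪ Y) \ (X ∪ E)) = Y ∪ E := by
    intro E hE
    ext i
    have a : i ∈ E → i ∉ X ∪ Y := fun h => disjoint_left.1 hE h
    have b : i ∈ X → i ∉ Y := fun h => disjoint_left.1 hXY h
    simp only [mem_union, mem_sdiff] at a ⊢
    tauto
  refine forall_congr' fun E => forall_congr' fun hE => ⟨fun h ρ => ?_, fun h S' R hR => ?_⟩
  · rintro ⟨S', R, hR, rfl⟩
    have := h S' R hR
    obtain rfl := hP _ _ _ hR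
    refine ⟨_, _, this, ?_⟩
    rw [lift_link, h1 E hE]
  · have := h (lift R) ⟨S', R, hR, rfl⟩
    obtain rfl := hP _ _ _ hR
    refine (kern_lift_iff (hQ E) (h2 E hE) _).1 ?_
    rwa [lift_link, h1 E hE]

namespace HType

theorem ele_of_adm {x : HType} {S : Finset QSystem} {M : Op S} (h : x.maps.adm S M) :
    S = x.ele := by
  cases x with
  | elem A => rw [maps] at h; exact h.1
  | arrow x y => rw [maps] at h; exact h.1

theorem ele_of_det {x : HType} {S : Finset QSystem} {M : Op S} (h : x.maps.det S M) :
    S = x.ele := by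
  cases x with
  | elem A => rw [maps] at h; exact h.1
  | arrow x y => rw [maps] at h; exact h.1.1

/-- Kernels of the admissible maps of a type. -/
def GAdm (x : HType) : (GConf → GConf → ℂ) → Prop := Kern x.maps.adm

/-- Kernels of the deterministic maps of a type. -/
def GDet (x : HType) : (GConf → GConf → ℂ) → Prop := Kern x.maps.det

theorem GDet.depOn {x : HType} {F : GConf → GConf → ℂ} (h : x.GDet F) : DepOn x.ele F :=
  Kern.depOn (fun _ _ => ele_of_det) h

theorem isDeterministic_iff {x : HType} {S : Finset QSystem} (M : Op S) :
    x.IsDeterministic M ↔ S = x.ele ∧ x.GDet (lift M) := by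
  refine ⟨fun h => ⟨ele_of_det h, S, M, h, rfl⟩, fun h => ?_⟩
  exact (kern_lift_iff (fun _ _ => ele_of_det) h.1 M).1 h.2

/-- `F` is completely admissible preserving. -/
def PresAdm (x y : HType) (F : GConf → GConf → ℂ) : Prop :=
  ∀ E : Finset QSystem, Disjoint E (x.ele ∪ y.ele) →
    ∀ ρ, (x.ext E).GAdm ρ → (y.ext E).GAdm (glink x.ele ρ F)

/-- `F` is completely determinism preserving. -/
def PresDet (x y : HType) (F : GConf → GConf → ℂ) : Prop :=
  ∀ E : Finset QSystem, Disjoint E (x.ele ∪ y.ele) →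
    ∀ ρ, (x.ext E).GDet ρ → (y.ext E).GDet (glink x.ele ρ F)

theorem preserves_adm_iff {x y : HType} (h : Disjoint x.ele y.ele) {S : Finset QSystem}
    (hS : S = x.ele ∪ y.ele) (M : Op S) :
    MapClass.Preserves x.ele y.ele (fun E => (x.ext E).maps.adm) (fun E => (y.ext E).maps.adm) M ↔
      PresAdm x y (lift M) :=
  preserves_iff (fun E _ _ hM => by rw [ele_of_adm hM, ele_ext])
    (fun E _ _ hM => by rw [ele_of_adm hM, ele_ext]) h hS M

theorem preserves_det_iff {x y : HType} (h : Disjoint x.ele y.ele) {S : Finset QSystem}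
    (hS : S = x.ele ∪ y.ele) (M : Op S) :
    MapClass.Preserves x.ele y.ele (fun E => (x.ext E).maps.det) (fun E => (y.ext E).maps.det) M ↔
      PresDet x y (lift M) :=
  preserves_iff (fun E _ _ hM => by rw [ele_of_det hM, ele_ext])
    (fun E _ _ hM => by rw [ele_of_det hM, ele_ext]) h hS M

theorem gAdm_arrow_iff {x y : HType} (h : Disjoint x.ele y.ele) {F : GConf → GConf → ℂ} :
    (arrow x y).GAdm F ↔ DepOn (x.ele ∪ y.ele) F ∧ PresAdm x y F ∧
      ∃ (n : ℕ) (N : Fin n → GConf → GConf → ℂ),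
        (∀ i, DepOn (x.ele ∪ y.ele) (N i) ∧ PresAdm x y (N i)) ∧ PresDet x y (F + ∑ i, N i) := by
  constructor
  · rintro ⟨S, M, hM, rfl⟩
    rw [maps] at hM
    obtain ⟨hS, h1, n, N, h2, h3⟩ := hM
    refine ⟨hS ▸ depOn_lift M, (preserves_adm_iff h hS M).1 h1, n, fun i => lift (N i),
      fun i => ⟨hS ▸ depOn_lift _, (preserves_adm_iff h hS _).1 (h2 i)⟩, ?_⟩
    rw [← lift_sum, ← lift_add]
    exact (preserves_det_iff h hS _).1 h3
  · rintro ⟨h0, h1, n, N, h2, h3⟩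
    refine ⟨x.ele ∪ y.ele, low _ F, ?_, lift_low h0⟩
    rw [maps]
    refine ⟨rfl, (preserves_adm_iff h rfl _).2 ((lift_low h0).symm ▸ h1), n,
      fun i => low _ (N i), fun i => (preserves_adm_iff h rfl _).2 ?_,
        (preserves_det_iff h rfl _).2 ?_⟩
    · rw [lift_low (h2 i).1]
      exact (h2 i).2
    · rw [lift_add, lift_sum, lift_low h0, Finset.sum_congr rfl fun i _ => lift_low (h2 i).1]
      exact h3

theorem gDet_arrow_iff {x y : HType} (h : Disjoint x.ele y.ele) {F : GConf → GConf → ℂ} :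
    (arrow x y).GDet F ↔ (arrow x y).GAdm F ∧ PresDet x y F := by
  constructor
  · rintro ⟨S, M, hM, rfl⟩
    rw [maps] at hM
    refine ⟨⟨S, M, ?_, rfl⟩, (preserves_det_iff h hM.1.1 M).1 hM.2⟩
    rw [maps]
    exact hM.1
  · rintro ⟨⟨S, M, hM, rfl⟩, h2⟩
    refine ⟨S, M, ?_, rfl⟩
    rw [maps] at hM ⊢
    exact ⟨hM, (preserves_det_iff h hM.1 M).2 h2⟩

/-- The facts about the maps of a type from which those of a composed type follow. -/
structure Regular (x : HType) : Prop where
  adm_iff : ∀ F, x.GAdm F ↔ DepOn x.ele F ∧ Pos F ∧ ∃ D, x.GDet D ∧ Pos (D - F)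
  pos : ∀ F, x.GDet F → Pos F
  isChannel : ∀ F, x.GDet F → IsChannel x.inputs x.outputs F
  of_isStateOn : ∀ F, Pos F → IsStateOn x.inputs x.outputs F → x.GDet F
  convex : ∀ F G, x.GDet F → x.GDet G → ∀ t : ℝ, 0 ≤ t → t ≤ 1 →
    x.GDet (((1 - t : ℝ) : ℂ) • F + (t : ℂ) • G)

theorem isStateOn_empty_iff {O : Finset QSystem} {F : GConf → GConf → ℂ} (hF : DepOn O F) :
    IsStateOn ∅ O F ↔ IsChannel ∅ O F := by
  constructor
  · intro h g g'
    rw [delta_of_agree fun i hi => absurd hi (notMem_empty i), ← h.sum_eq g]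
    refine Finset.sum_congr rfl fun s _ => ?_
    exact hF _ _ _ _ Agree.rfl (agree_upd_upd_iff.2 rfl)
  · intro h
    refine ⟨fun g g' k => absurd (fun i hi => absurd hi (notMem_empty i)) k,
      fun g g' h h' _ _ e e' => hF _ _ _ _ e e', fun g => ?_⟩
    rw [h, delta_of_agree Agree.rfl]

theorem trace_eq_one_iff {S : Finset QSystem} (M : Op S) :
    M.trace = 1 ↔ IsStateOn ∅ S (lift M) := by
  have : ∀ g : GConf, ∑ s : Conf S, lift M (upd g s) (upd g s) = M.trace := by
    intro g
    simp [lift, Matrix.trace]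
  constructor
  · intro h
    refine ⟨fun g g' k => absurd (fun i hi => absurd hi (notMem_empty i)) k,
      fun g g' h h' _ _ e e' => depOn_lift M _ _ _ _ e e', fun g => ?_⟩
    rw [this, h]
  · intro h
    rw [← this fun _ => 0, h.sum_eq]

theorem gDet_elem_iff {S : Finset QSystem} {F : GConf → GConf → ℂ} :
    (elem S).GDet F ↔ Pos F ∧ IsStateOn ∅ S F := by
  constructor
  · rintro ⟨T, M, hM, rfl⟩
    rw [maps] at hM
    obtain ⟨rfl, h1, h2⟩ := hM
    exact ⟨(pos_lift_iff M).2 h1, (trace_eq_one_iff M).1 h2⟩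
  · rintro ⟨h1, h2⟩
    have hd : DepOn S F := by simpa using h2.depOn
    refine ⟨S, low S F, ?_, lift_low hd⟩
    rw [maps]
    refine ⟨rfl, (pos_lift_iff _).1 ?_, (trace_eq_one_iff _).2 ?_⟩
    · rwa [lift_low hd]
    · rwa [lift_low hd]

theorem regular_elem (S : Finset QSystem) : (elem S).Regular where
  adm_iff F := by
    constructor
    · rintro ⟨T, M, hM, rfl⟩
      rw [maps] at hM
      obtain ⟨rfl, h1, N, ⟨h2, h3⟩, h4⟩ := hM
      refine ⟨depOn_lift M, (pos_lift_iff M).2 h1, lift N, ?_, ?_⟩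
      · exact gDet_elem_iff.2 ⟨(pos_lift_iff N).2 h2, (trace_eq_one_iff N).1 h3⟩
      · rw [← lift_sub]
        exact (pos_lift_iff _).2 h4
    · rintro ⟨h1, h2, D, hD, h3⟩
      have hDd := hD.depOn
      rw [gDet_elem_iff] at hD
      simp only [ele] at h1 hDd
      refine ⟨S, low S F, ?_, lift_low h1⟩
      rw [maps]
      refine ⟨rfl, (pos_lift_iff _).1 ?_, low S D, ⟨(pos_lift_iff _).1 ?_,
        (trace_eq_one_iff _).2 ?_⟩, (pos_lift_iff _).1 ?_⟩
      · rwa [lift_low h1]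
      · rw [lift_low hDd]; exact hD.1
      · rw [lift_low hDd]; exact hD.2
      · rwa [lift_sub, lift_low h1, lift_low hDd]
  pos F h := (gDet_elem_iff.1 h).1
  isChannel F h := by
    have hd := h.depOn
    rw [inputs_elem, outputs_elem]
    exact (isStateOn_empty_iff hd).1 (gDet_elem_iff.1 h).2
  of_isStateOn F h h' := by
    rw [inputs_elem, outputs_elem] at h'
    exact gDet_elem_iff.2 ⟨h, h'⟩
  convex F G hF hG t h0 h1 := by
    rw [gDet_elem_iff] at hF hG ⊢
    refine ⟨(hF.1.smul (sub_nonneg.2 h1)).add (hG.1.smul h0), fun g g' k =>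
      absurd (fun i hi => absurd hi (notMem_empty i)) k, fun g g' h h' a a' e e' => ?_,
      fun g => ?_⟩
    · simp only [Pi.add_apply, Pi.smul_apply, hF.2.congr _ _ _ _ a a' e e',
        hG.2.congr _ _ _ _ a a' e e']
    · simp only [Pi.add_apply, Pi.smul_apply, Finset.sum_add_distrib, ← Finset.smul_sum,
        hF.2.sum_eq, hG.2.sum_eq]
      simp

/-! ### Regularity passes to composed types -/

section Arrow

variable {x y : HType}

/-- If ρ ≤ σ and F ≤ D, then `σ * D - ρ * F = (σ - ρ) * D + ρ * (D - F)` is positive. -/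
theorem presAdm_of_dominated
    (hx : ∀ E, Disjoint E (x.ele ∪ y.ele) → (x.ext E).Regular)
    (hy : ∀ E, Disjoint E (x.ele ∪ y.ele) → (y.ext E).Regular) {F D : GConf → GConf → ℂ}
    (hF : DepOn (x.ele ∪ y.ele) F) (hF' : Pos F) (hD : PresDet x y D) (hDF : Pos (D - F)) :
    PresAdm x y F := by
  intro E hE ρ hρ
  obtain ⟨h1, h2, σ, h3, h4⟩ := ((hx E hE).adm_iff ρ).1 hρ
  refine ((hy E hE).adm_iff _).2 ⟨?_, h2.glink hF' _, glink x.ele σ D, hD E hE σ h3, ?_⟩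
  · refine glink_depOn h1 hF fun i hi => ?_
    simp only [ele_ext, mem_sdiff, mem_union] at hi ⊢
    tauto
  · have hD' : Pos D := by simpa using hF'.add hDF
    have := (h4.glink hD' x.ele).add (h2.glink hDF x.ele)
    have e1 := glink_add_left x.ele (σ - ρ) ρ D
    have e2 := glink_add_right x.ele ρ (D - F) F
    rw [sub_add_cancel] at e1 e2
    rw [e2, ← add_assoc] at e1
    rwa [e1, add_sub_cancel_right]

/-- Choi's theorem: apply F to half of an unnormalized maximally entangled vector between `x.ele`
and a fresh copy E of it. The result is F, up to scale and relabelling, and it is positive because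
it is admissible. -/
theorem pos_of_presAdm
    (hx : ∀ E, Disjoint E (x.ele ∪ y.ele) → (x.ext E).Regular)
    (hy : ∀ E, Disjoint E (x.ele ∪ y.ele) → (y.ext E).Regular) {F : GConf → GConf → ℂ}
    (hF : DepOn (x.ele ∪ y.ele) F) (hP : PresAdm x y F) : Pos F := by
  classical
  set N : ℕ := (x.ele ∪ y.ele).sup QSystem.label + 1 with hN
  have hlab : ∀ i ∈ x.ele ∪ y.ele, i.label < N := fun i hi =>
    Nat.lt_succ_of_le (Finset.le_sup (f := QSystem.label) hi)
  -- Shifting labels by N, beyond every label in use, makes the copy disjoint from x and y; `us`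
  -- undoes the shift.
  let sh : QSystem → QSystem := fun i => ⟨i.dim, i.two_le_dim, i.label + N⟩
  let us : QSystem → QSystem := fun i => ⟨i.dim, i.two_le_dim, i.label - N⟩
  have hus : ∀ i, us (sh i) = i := by
    rintro ⟨d, hd, l⟩
    simp [us, sh]
  let E : Finset QSystem := x.ele.image sh
  have hshE : ∀ i ∈ x.ele, sh i ∈ E := fun i hi => mem_image_of_mem _ hi
  have hE : Disjoint E (x.ele ∪ y.ele) := by
    refine disjoint_left.2 fun j hj hj' => ?_
    obtain ⟨i, hi, rfl⟩ := mem_image.1 hj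
    have := hlab _ hj'
    simp [sh] at this
  have hEx : Disjoint E x.ele := (disjoint_union_right.1 hE).1
  let v : GConf → ℂ := fun g => if ∀ i ∈ x.ele, g i = g (sh i) then 1 else 0
  let W := (x.ext E).ele
  have hW : W = x.ele ∪ E := ele_ext x E
  have hWio : (x.ext E).inputs ∪ (x.ext E).outputs = W := inputs_union_outputs _
  have hv : ∀ g h, Agree W g h → v g = v h := by
    intro g h e
    rw [hW, agree_union] at e
    have : (∀ i ∈ x.ele, g i = g (sh i)) ↔ ∀ i ∈ x.ele, h i = h (sh i) := by
      refine forall_congr' fun i => forall_congr' fun hi => ?_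
      rw [e.1 i hi, e.2 _ (hshE i hi)]
    simp only [v, this]
  have hvr : ∀ g, star (v g) = v g := fun g => by simp only [v]; split_ifs <;> simp
  obtain ⟨m, hm⟩ : ∃ m : ℂ,
    m = ∑ s : Conf W, v (upd (fun _ => 0) s) * star (v (upd (fun _ => 0) s)) := ⟨_, rfl⟩
  obtain ⟨r, hr0, hrm⟩ : ∃ r : ℝ, 0 < r ∧ m = r := by
    refine ⟨∑ s : Conf W, Complex.normSq (v (upd (fun _ => 0) s)), ?_, ?_⟩
    · refine Finset.sum_pos' (fun s _ => Complex.normSq_nonneg _) ⟨fun _ => 0, mem_univ _, ?_⟩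
      rw [Complex.normSq_pos]
      have : v (upd (fun _ => 0) (fun _ => 0 : Conf W)) = 1 := by
        refine if_pos fun i hi => ?_
        simp only [upd]
        split_ifs <;> rfl
      rw [this]
      exact one_ne_zero
    · rw [hm, Complex.ofReal_sum]
      exact Finset.sum_congr rfl fun s _ => Complex.mul_conj _
  set c : ℝ := ((Fintype.card (Conf (x.ext E).outputs) : ℝ))⁻¹ with hc
  have hc0 : 0 < c := inv_pos.2 (Nat.cast_pos.2 Fintype.card_pos)
  let V : GConf → GConf → ℂ := fun g g' => v g * star (v g')
  have hVpos : Pos V := pos_of_fintype (ι := Unit) (fun _ => v) fun g g' => by simp [V]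
  have hR := hx E hE
  -- The maximally mixed state tensored with the identity is `c • delta W`, deterministic by
  -- `of_isStateOn`. It dominates `|v⟩⟨v|` scaled by c/r, where r is the squared norm of v.
  have hadm : (x.ext E).GAdm (((c * r⁻¹ : ℝ) : ℂ) • V) := by
    refine (hR.adm_iff _).2 ⟨fun g g' h h' e e' => ?_, hVpos.smul (by positivity),
      (c : ℂ) • delta W, hR.of_isStateOn _ ((delta_pos W).smul hc0.le) ?_, ?_⟩
    · simp only [Pi.smul_apply, V, hv _ _ e, hv _ _ e']
    · have := mixed_isStateOn (x.ext E).inputs (x.ext E).outputs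
      rw [hWio] at this
      convert this using 3
      simp [hc]
    · have := (pos_delta_sub hv hm).smul hc0.le
      convert this using 1
      funext g g'
      simp only [Pi.sub_apply, Pi.smul_apply, smul_eq_mul, hrm, V]
      push_cast
      ring
  have hlink := (((hy E hE).adm_iff _).1 (hP E hE _ hadm)).2.1
  -- Copies the labels of x onto E, so that in the link only the summand `s = restr x.ele g`
  -- survives.
  let φ : GConf → GConf := fun g j => if j ∈ E then g (us j) else g j
  have hφv : ∀ (g : GConf) (s : Conf x.ele),
      v (upd (φ g) s) = if s = restr x.ele g then 1 else 0 := by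
    intro g s
    have : (∀ i ∈ x.ele, upd (φ g) s i = upd (φ g) s (sh i)) ↔ s = restr x.ele g := by
      have key : ∀ i (hi : i ∈ x.ele), upd (φ g) s i = s ⟨i, hi⟩ ∧
          upd (φ g) s (sh i) = g i := by
        intro i hi
        refine ⟨upd_of_mem _ _ hi, ?_⟩
        rw [upd_of_notMem _ _ fun k => disjoint_left.1 hEx (hshE i hi) k]
        have e1 : φ g (sh i) = g (us (sh i)) := if_pos (hshE i hi)
        rw [e1]
        exact Fin.ext (congrArg (fun j : QSystem => (g j : ℕ)) (hus i))
      constructor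
      · intro k
        funext i
        have := k i.1 i.2
        rwa [(key i.1 i.2).1, (key i.1 i.2).2] at this
      · rintro k i hi
        rw [(key i hi).1, (key i hi).2, k]
        rfl
    simp only [v, this]
  have hφ : ∀ g, Agree (x.ele ∪ y.ele) (upd (φ g) (restr x.ele g)) g := by
    intro g i hi
    by_cases hix : i ∈ x.ele
    · rw [upd_of_mem _ _ hix]; rfl
    · rw [upd_of_notMem _ _ hix]
      exact if_neg fun k => disjoint_left.1 hE k hi
  have hfin : F = (((c * r⁻¹)⁻¹ : ℝ) : ℂ) •
      fun g g' => glink x.ele (((c * r⁻¹ : ℝ) : ℂ) • V) F (φ g) (φ g') := by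
    have hne : ((c * r⁻¹ : ℝ) : ℂ) ≠ 0 := Complex.ofReal_ne_zero.2 (by positivity)
    funext g g'
    have : glink x.ele (((c * r⁻¹ : ℝ) : ℂ) • V) F (φ g) (φ g') = ((c * r⁻¹ : ℝ) : ℂ) * F g g' := by
      simp only [glink, Pi.smul_apply, V, hvr, hφv, smul_eq_mul]
      rw [Finset.sum_eq_single (restr x.ele g), Finset.sum_eq_single (restr x.ele g')]
      · rw [if_pos rfl, if_pos rfl, hF _ _ _ _ (hφ g) (hφ g')]
        ring
      · intro s _ hs
        simp [hs]
      · simp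
      · intro s _ hs
        simp [hs]
      · simp
    simp only [Pi.smul_apply, this, smul_eq_mul]
    rw [← mul_assoc, ← Complex.ofReal_mul, inv_mul_cancel₀ (by positivity), Complex.ofReal_one,
      one_mul]
  rw [hfin]
  exact (hlink.comp φ).smul (by positivity)

/-- No complementary maps are needed: a positive, determinism preserving F is dominated by itself,
hence admissibility preserving. -/
theorem gDet_arrow_iff_pos (h : Disjoint x.ele y.ele)
    (hx : ∀ E, Disjoint E (x.ele ∪ y.ele) → (x.ext E).Regular)
    (hy : ∀ E, Disjoint E (x.ele ∪ y.ele) → (y.ext E).Regular) {F : GConf → GConf → ℂ} :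
    (arrow x y).GDet F ↔ DepOn (x.ele ∪ y.ele) F ∧ Pos F ∧ PresDet x y F := by
  rw [gDet_arrow_iff h]
  constructor
  · rintro ⟨h1, h2⟩
    rw [gAdm_arrow_iff h] at h1
    exact ⟨h1.1, pos_of_presAdm hx hy h1.1 h1.2.1, h2⟩
  · rintro ⟨h1, h2, h3⟩
    refine ⟨(gAdm_arrow_iff h).2 ⟨h1, presAdm_of_dominated hx hy h1 h2 h3 ?_, 0, fun _ => 0,
      fun i => i.elim0, by simpa using h3⟩, h3⟩
    simpa using pos_zero

theorem gAdm_arrow_iff_pos (h : Disjoint x.ele y.ele)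
    (hx : ∀ E, Disjoint E (x.ele ∪ y.ele) → (x.ext E).Regular)
    (hy : ∀ E, Disjoint E (x.ele ∪ y.ele) → (y.ext E).Regular) {F : GConf → GConf → ℂ} :
    (arrow x y).GAdm F ↔ DepOn (x.ele ∪ y.ele) F ∧ Pos F ∧
      ∃ D, (arrow x y).GDet D ∧ Pos (D - F) := by
  constructor
  · intro hA
    rw [gAdm_arrow_iff h] at hA
    obtain ⟨h1, h2, n, N, h3, h4⟩ := hA
    have hN : Pos (∑ i, N i) :=
      Pos.sum _ fun i _ => pos_of_presAdm hx hy (h3 i).1 (h3 i).2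
    have hFp := pos_of_presAdm hx hy h1 h2
    refine ⟨h1, hFp, F + ∑ i, N i, ?_, by simpa using hN⟩
    refine (gDet_arrow_iff_pos h hx hy).2 ⟨fun g g' k k' e e' => ?_, hFp.add hN, h4⟩
    simp only [Pi.add_apply, Finset.sum_apply, h1 _ _ _ _ e e', (h3 _).1 _ _ _ _ e e']
  · rintro ⟨h1, h2, D, h3, h4⟩
    rw [gDet_arrow_iff_pos h hx hy] at h3
    obtain ⟨h5, h6, h7⟩ := h3
    have h8 : DepOn (x.ele ∪ y.ele) (D - F) := fun g g' k k' e e' => by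
      simp only [Pi.sub_apply, h1 _ _ _ _ e e', h5 _ _ _ _ e e']
    -- A single complementary map, `D - F`, suffices.
    refine (gAdm_arrow_iff h).2 ⟨h1, presAdm_of_dominated hx hy h1 h2 h7 h4, 1, fun _ => D - F,
      fun _ => ⟨h8, presAdm_of_dominated hx hy h8 h4 h7 ?_⟩, ?_⟩
    · simpa using h2
    · simpa using h7

theorem regular_arrow (h : Disjoint x.ele y.ele) (hnx : x.NoRepeat) (hny : y.NoRepeat)
    (hx : ∀ E, Disjoint E (x.ele ∪ y.ele) → (x.ext E).Regular)
    (hy : ∀ E, Disjoint E (x.ele ∪ y.ele) → (y.ext E).Regular) : (arrow x y).Regular where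
  adm_iff F := gAdm_arrow_iff_pos h hx hy
  pos F hF := ((gDet_arrow_iff_pos h hx hy).1 hF).2.1
  isChannel F hF := by
    obtain ⟨h1, h2, h3⟩ := (gDet_arrow_iff_pos h hx hy).1 hF
    have he : Disjoint ∅ (x.ele ∪ y.ele) := disjoint_empty_left _
    rw [inputs_arrow h, outputs_arrow h]
    refine isChannel_of_glink_pureOn x.disjoint_inputs_outputs ?_ fun w hw hw1 => ?_
    · rwa [inputs_union_outputs, inputs_union_outputs]
    · rw [inputs_union_outputs]
      have hst := pureOn_isStateOn (I := x.inputs) hw hw1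
      have := (hy ∅ he).isChannel _ (h3 ∅ he (pureOn x.inputs w) ?_)
      · rwa [inputs_ext hny (disjoint_empty_left _), outputs_ext hny (disjoint_empty_left _),
          union_empty] at this
      · refine (hx ∅ he).of_isStateOn _ (pureOn_pos _ _) ?_
        rwa [inputs_ext hnx (disjoint_empty_left _), outputs_ext hnx (disjoint_empty_left _),
          union_empty]
  of_isStateOn F hF hF' := by
    rw [inputs_arrow h, outputs_arrow h] at hF'
    refine (gDet_arrow_iff_pos h hx hy).2 ⟨?_, hF, fun E hE ρ hρ => ?_⟩
    · refine hF'.depOn.mono fun i hi => ?_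
      rw [← x.inputs_union_outputs, ← y.inputs_union_outputs]
      simp only [mem_union] at hi ⊢
      tauto
    · have hE' := disjoint_union_right.1 hE
      refine (hy E hE).of_isStateOn _ (((hx E hE).pos _ hρ).glink hF _) ?_
      rw [inputs_ext hny hE'.2, outputs_ext hny hE'.2, ← x.inputs_union_outputs]
      have hd := hρ.depOn
      have hch := (hx E hE).isChannel _ hρ
      rw [inputs_ext hnx hE'.1, outputs_ext hnx hE'.1] at hch
      rw [ele_ext, ← x.inputs_union_outputs] at hd
      refine IsStateOn.glink x.disjoint_inputs_outputs ?_ ?_ hF' hd hch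
      · rwa [inputs_union_outputs, inputs_union_outputs]
      · rwa [inputs_union_outputs, inputs_union_outputs]
  convex F G hF hG t h0 h1 := by
    rw [gDet_arrow_iff_pos h hx hy] at hF hG ⊢
    refine ⟨fun g g' k k' e e' => ?_, (hF.2.1.smul (sub_nonneg.2 h1)).add (hG.2.1.smul h0),
      fun E hE ρ hρ => ?_⟩
    · simp only [Pi.add_apply, Pi.smul_apply, hF.1 _ _ _ _ e e', hG.1 _ _ _ _ e e']
    · rw [glink_add_right, glink_smul_right, glink_smul_right]
      exact (hy E hE).convex _ _ (hF.2.2 E hE ρ hρ) (hG.2.2 E hE ρ hρ) t h0 h1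

end Arrow

/-- Structural induction does not apply, since `y.ext E` is not a subterm of `arrow x y`; extension
preserves the number of arrows, which serves as the measure. -/
theorem NoRepeat.regular {x : HType} (hx : x.NoRepeat) : x.Regular := by
  induction hn : x.arrows using Nat.strong_induction_on generalizing x with
  | _ n ih =>
    cases x with
    | elem A => exact regular_elem A
    | arrow x y =>
      simp only [arrows] at hn
      refine regular_arrow hx.2.2 hx.1 hx.2.1 (fun E hE => ?_) fun E hE => ?_
      · exact ih _ (by rw [arrows_ext]; omega) (hx.1.ext (disjoint_union_right.1 hE).1) rfl
      · exact ih _ (by rw [arrows_ext]; omega) (hx.2.1.ext (disjoint_union_right.1 hE).2) rfl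

end HType

/-! ### Contractions -/

/-- `IsStateOn.glink` is used with the roles exchanged: F is the channel being linked and the input
state is the `σ ⊗ 1` with no identity part. The link is symmetric in its two kernels. -/
theorem IsChannel.elem_arrow_elem {I O : Finset QSystem} (hd : Disjoint I O)
    {F : GConf → GConf → ℂ} (hF : DepOn (I ∪ O) F) (hp : Pos F) (hc : IsChannel I O F) :
    (HType.arrow (.elem I) (.elem O)).GDet F := by
  refine (HType.gDet_arrow_iff_pos (x := .elem I) (y := .elem O) hd
    (fun E _ => HType.regular_elem _) fun E _ => HType.regular_elem _).2 ⟨hF, hp, fun E hE ρ hρ => ?_⟩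
  rw [HType.ext, HType.gDet_elem_iff] at hρ ⊢
  refine ⟨hρ.1.glink hp _, ?_⟩
  simp only [HType.ele] at hE ⊢
  have hE' := disjoint_union_right.1 hE
  have := IsStateOn.glink (Ix := I) (Ox := ∅) (Iy := ∅) (Oy := E) (E := O) (ρ := F) (F := ρ)
    (disjoint_empty_right _) (by simpa using hE'.1.symm) (by simpa using ⟨hd.symm, hE'.2.symm⟩)
    (by simpa using hρ.2) (by simpa using hF) (by simpa using hc)
  rw [union_empty, union_comm] at this
  convert this using 1
  funext g g'
  simp only [glink, mul_comm]

/-- The contraction of a kernel. -/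
noncomputable def gcontract (A B : QSystem) (F : GConf → GConf → ℂ) : GConf → GConf → ℂ :=
  glink {A, B} F (lift (phi A B))

theorem lift_contract {A B : QSystem} {S : Finset QSystem} (hA : A ∈ S) (hB : B ∈ S) (R : Op S) :
    lift (contract A B R) = gcontract A B (lift R) := by
  rw [contract, lift_link, gcontract, inter_eq_right.2 (by simp [insert_subset_iff, hA, hB])]

theorem gcontract_combination (A B : QSystem) (F G : GConf → GConf → ℂ) (a b : ℂ) :
    gcontract A B (a • F + b • G) = a • gcontract A B F + b • gcontract A B G := by
  funext g g'
  simp only [gcontract, glink, Pi.add_apply, Pi.smul_apply, smul_eq_mul, Finset.mul_sum, add_mul,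
    Finset.sum_add_distrib, mul_assoc]

theorem lift_phi_upd {A B : QSystem} (g g' : GConf) (s s' : Conf {A, B}) :
    lift (phi A B) (upd g s) (upd g' s') =
      if (upd g s A : ℕ) = upd g s B ∧ (upd g' s' A : ℕ) = upd g' s' B then 1 else 0 := rfl

/-- The indicator of the configurations that agree with `k` on `O`. -/
noncomputable def indicator (O : Finset QSystem) (k g : GConf) : ℂ :=
  open Classical in if Agree O g k then 1 else 0

theorem indicator_congr {O : Finset QSystem} {k g h : GConf} (e : Agree O g h) :
    indicator O k g = indicator O k h := by
  unfold indicator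
  by_cases hk : Agree O h k
  · rw [if_pos hk, if_pos (e.trans hk)]
  · rw [if_neg hk, if_neg fun h' => hk (e.symm.trans h')]

theorem indicator_of_not_agree {O : Finset QSystem} {k g : GConf} (e : ¬ Agree O g k) :
    indicator O k g = 0 := if_neg e

theorem indicator_of_agree {O : Finset QSystem} {k g : GConf} (e : Agree O g k) :
    indicator O k g = 1 := if_pos e

theorem indicator_mul_star (O : Finset QSystem) (k g : GConf) :
    indicator O k g * star (indicator O k g) = indicator O k g := by
  unfold indicator
  split_ifs <;> simp

theorem pureOn_indicator_isStateOn (I O : Finset QSystem) (k : GConf) :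
    IsStateOn I O (pureOn I (indicator O k)) := by
  refine pureOn_isStateOn (fun g h e => indicator_congr e) fun g => ?_
  simp only [indicator_mul_star]
  rw [Finset.sum_eq_single (restr O k)]
  · exact indicator_of_agree (restr_eq_iff.1 (restr_upd _ _))
  · intro s _ hs
    exact indicator_of_not_agree fun e => hs (by rw [← restr_eq_iff.2 e, restr_upd])
  · simp

theorem gDet_pureOn_indicator {x : HType} (hx : x.NoRepeat) (k : GConf) :
    x.GDet (pureOn x.inputs (indicator x.outputs k)) :=
  hx.regular.of_isStateOn _ (pureOn_pos _ _) (pureOn_indicator_isStateOn _ _ k)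

theorem exists_isDeterministic {x : HType} {F : GConf → GConf → ℂ} (hF : x.GDet F) :
    ∃ R : Op x.ele, x.IsDeterministic R ∧ lift R = F := by
  have := lift_low hF.depOn
  exact ⟨low x.ele F, (HType.isDeterministic_iff _).2 ⟨rfl, this.symm ▸ hF⟩, this⟩

/-- What admissibility of a contraction says about kernels. -/
theorem ContractionAdmissible.exists_gDet {A B : QSystem} {x : HType}
    (h : ContractionAdmissible A B x) (hA : A ∈ x.ele) (hB : B ∈ x.ele) {F : GConf → GConf → ℂ}
    (hF : x.GDet F) :
    ∃ z : HType, z.NoRepeat ∧ z.ele = x.ele \ {A, B} ∧ z.GDet (gcontract A B F) := by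
  obtain ⟨R, hR, rfl⟩ := exists_isDeterministic hF
  obtain ⟨z, hz, hd⟩ := h R hR
  obtain ⟨h1, h2⟩ := (HType.isDeterministic_iff _).1 hd
  refine ⟨z, hz, ?_, by rwa [← lift_contract hA hB]⟩
  rw [← h1, sdiff_eq_empty_iff_subset.2 (by simp [insert_subset_iff, hA, hB] : {A, B} ⊆ x.ele),
    union_empty]

/-! ### Contracting two systems on the same side -/

theorem not_admissible_of_outputs {x : HType} (hx : x.NoRepeat) {A B : QSystem} (hAB : A ≠ B)
    (hA : A ∈ x.outputs) (hB : B ∈ x.outputs) : ¬ ContractionAdmissible A B x := by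
  intro h
  -- A basis state with label 1 on B and 0 on A, so that no summand meets the constraint of `phi A
  -- B`.
  let k : GConf := fun i => if i = B then ⟨1, i.two_le_dim⟩ else 0
  obtain ⟨z, hz, -, hd⟩ := h.exists_gDet (x.outputs_subset_ele hA) (x.outputs_subset_ele hB)
    (gDet_pureOn_indicator hx k)
  have h0 : gcontract A B (pureOn x.inputs (indicator x.outputs k)) = 0 := by
    funext g g'
    refine Finset.sum_eq_zero fun s _ => Finset.sum_eq_zero fun s' _ => ?_
    rw [lift_phi_upd]
    split_ifs with hs
    · have : indicator x.outputs k (upd g s) = 0 := by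
        refine indicator_of_not_agree fun e => ?_
        have h1 := hs.1
        rw [e A hA, e B hB] at h1
        simp [k, hAB] at h1
      simp [pureOn, this]
    · rw [mul_zero]
  have := hz.regular.isChannel _ hd (fun _ => 0) (fun _ => 0)
  rw [h0, delta_of_agree Agree.rfl] at this
  simp at this

/-- The identity on A and B contracts to the number of matching pairs of labels, at least 2, whereas
diagonal entries of a positive channel are at most 1. -/
theorem not_admissible_of_inputs {x : HType} (hx : x.NoRepeat) {A B : QSystem}
    (hA : A ∈ x.inputs) (hB : B ∈ x.inputs) :
    ¬ ContractionAdmissible A B x := by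
  intro h
  obtain ⟨z, hz, -, hd⟩ := h.exists_gDet (x.inputs_subset_ele hA) (x.inputs_subset_ele hB)
    (gDet_pureOn_indicator hx fun _ => 0)
  set C := gcontract A B (pureOn x.inputs (indicator x.outputs fun _ => 0)) with hC
  have hsub : ({A, B} : Finset QSystem) ⊆ x.inputs := by simp [insert_subset_iff, hA, hB]
  have hdisj : Disjoint x.outputs {A, B} := x.disjoint_inputs_outputs.symm.mono_right hsub
  have hone : ∀ s : Conf {A, B}, indicator x.outputs (fun _ => 0) (upd (fun _ => 0) s) = 1 :=
    fun s => indicator_of_agree (agree_upd_self hdisj _ _)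
  have hval : C (fun _ => 0) (fun _ => 0) =
      ((Finset.univ.filter fun s : Conf {A, B} =>
        (upd (fun _ => 0) s A : ℕ) = upd (fun _ => 0) s B).card : ℂ) := by
    rw [hC, gcontract, glink, Finset.card_filter, Nat.cast_sum]
    refine Finset.sum_congr rfl fun s _ => ?_
    rw [Finset.sum_eq_single s]
    · simp [pureOn, hone, lift_phi_upd, delta_of_agree Agree.rfl]
    · intro s' _ hs'
      rw [pureOn, delta_of_not_agree, zero_mul, zero_mul]
      exact fun e => hs' (agree_upd_upd_iff.1 (e.mono hsub)).symm
    · simp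
  have hle : C (fun _ => 0) (fun _ => 0) ≤ 1 := by
    have hch := hz.regular.isChannel _ hd (fun _ => 0) (fun _ => 0)
    rw [delta_of_agree Agree.rfl] at hch
    rw [← hch]
    have := Finset.single_le_sum (f := fun s : Conf z.outputs => C (upd (fun _ => 0) s)
      (upd (fun _ => 0) s)) (fun s _ => (hz.regular.pos _ hd).diag_nonneg _)
      (Finset.mem_univ (restr z.outputs fun _ => 0))
    simpa using this
  rw [hval] at hle
  have hle' := Finset.card_le_one.1 (by exact_mod_cast hle :
    (Finset.univ.filter fun s : Conf {A, B} =>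
        (upd (fun _ => 0) s A : ℕ) = upd (fun _ => 0) s B).card ≤ 1)
  -- The labels 00 and 11 are two distinct matching pairs.
  have := hle' (fun _ => 0) (by simp [upd]) (fun i => ⟨1, i.1.two_le_dim⟩) (by simp [upd])
  have := congrArg Fin.val (congrFun this ⟨A, by simp⟩)
  simp at this

/-! ### Contracting an input with an output -/

theorem gcontract_pureOn {I O : Finset QSystem} (hd : Disjoint I O) {A B : QSystem}
    (hA : A ∈ I) (hB : B ∈ O) :
    gcontract A B (pureOn I (indicator O fun _ => 0)) =
      pureOn (I \ {A}) (indicator (O \ {B}) fun _ => 0) := by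
  have hAO : A ∉ O := disjoint_left.1 hd hA
  have hBI : B ∉ I := disjoint_right.1 hd hB
  have key : ∀ (g : GConf) (s : Conf {A, B}), (upd g s A : ℕ) = upd g s B → s ≠ (fun _ => 0) →
      indicator O (fun _ => 0) (upd g s) = 0 := by
    intro g s h1 h2
    refine indicator_of_not_agree fun e => h2 ?_
    have h3 := e B hB
    have h4 : upd g s A = 0 := by
      apply Fin.ext
      rw [h1, h3]
      rfl
    funext i
    obtain ⟨i, hi⟩ := i
    rw [← upd_of_mem g s hi]
    rcases mem_insert.1 hi with rfl | hi'
    · exact h4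
    · obtain rfl := mem_singleton.1 hi'
      exact h3
  have h0 : ∀ g : GConf, indicator O (fun _ => 0) (upd g (fun _ => 0 : Conf {A, B})) =
      indicator (O \ {B}) (fun _ => 0) g := by
    intro g
    have : Agree O (upd g (fun _ => 0 : Conf {A, B})) (fun _ => 0) ↔
        Agree (O \ {B}) g (fun _ => 0) := by
      constructor
      · intro e i hi
        rw [mem_sdiff, mem_singleton] at hi
        rw [← e i hi.1, upd_of_notMem]
        simp only [mem_insert, mem_singleton, not_or]
        exact ⟨fun h => hAO (h ▸ hi.1), hi.2⟩
      · intro e i hi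
        by_cases h : i ∈ ({A, B} : Finset QSystem)
        · rw [upd_of_mem _ _ h]
        · rw [upd_of_notMem _ _ h]
          refine e i ?_
          simp only [mem_insert, mem_singleton, not_or] at h
          simp [hi, h.2]
    by_cases h : Agree (O \ {B}) g (fun _ => 0)
    · rw [indicator_of_agree h, indicator_of_agree (this.2 h)]
    · rw [indicator_of_not_agree h, indicator_of_not_agree fun k => h (this.1 k)]
  have hdel : ∀ g g' : GConf, delta I (upd g (fun _ => 0 : Conf {A, B}))
      (upd g' (fun _ => 0 : Conf {A, B})) = delta (I \ {A}) g g' := by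
    intro g g'
    have : Agree I (upd g (fun _ => 0 : Conf {A, B})) (upd g' (fun _ => 0 : Conf {A, B})) ↔
        Agree (I \ {A}) g g' := by
      have hI : I \ {A} = I \ {A, B} := by
        ext i
        have : i = B → i ∉ I := fun h => h ▸ hBI
        simp only [mem_sdiff, mem_insert, mem_singleton]
        tauto
      rw [hI]
      refine ⟨fun e i hi => ?_, fun e => e.upd _⟩
      have hi' := mem_sdiff.1 hi
      have := e i hi'.1
      rwa [upd_of_notMem _ _ hi'.2, upd_of_notMem _ _ hi'.2] at this
    by_cases h : Agree (I \ {A}) g g'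
    · rw [delta_of_agree h, delta_of_agree (this.2 h)]
    · rw [delta_of_not_agree h, delta_of_not_agree fun k => h (this.1 k)]
  funext g g'
  rw [gcontract, glink, Finset.sum_eq_single fun _ => 0, Finset.sum_eq_single fun _ => 0]
  · rw [pureOn, pureOn, h0, h0, hdel, lift_phi_upd, if_pos (by simp [upd]), mul_one]
  · intro s _ hs
    rw [lift_phi_upd]
    split_ifs with h
    · rw [pureOn, key _ _ h.2 hs]
      simp
    · rw [mul_zero]
  · simp
  · intro s _ hs
    refine Finset.sum_eq_zero fun s' _ => ?_
    rw [lift_phi_upd]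
    split_ifs with h
    · rw [pureOn, key _ _ h.1 hs]
      simp
    · rw [mul_zero]
  · simp

/-- On the diagonal, the channel condition says that every configuration has exactly one change of
its K labels that makes all O labels 0. A system in J and O, set to 1, would leave none; a system in
I and K would leave at least two. -/
theorem eq_of_isChannel_pureOn {I O J K : Finset QSystem} (hd : Disjoint I O) (hJK : Disjoint J K)
    (h : J ∪ K = I ∪ O) (hc : IsChannel J K (pureOn I (indicator O fun _ => 0))) : J = I := by
  classical
  have hsum : ∀ g : GConf, (Finset.univ.filter fun s : Conf K =>
      Agree O (upd g s) fun _ => 0).card = 1 := by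
    intro g
    have := hc g g
    simp only [pureOn, delta_of_agree Agree.rfl, one_mul, indicator_mul_star] at this
    rw [Finset.card_filter, ← Nat.cast_inj (R := ℂ), Nat.cast_sum, Nat.cast_one, ← this]
    refine Finset.sum_congr rfl fun s _ => ?_
    by_cases hs : Agree O (upd g s) fun _ => 0
    · simp [hs, indicator_of_agree hs]
    · simp [hs, indicator_of_not_agree hs]
  let e : QSystem → GConf := fun i j => if j = i then ⟨1, j.two_le_dim⟩ else 0
  have he : ∀ i, e i i ≠ 0 := fun i h => by
    have := congrArg Fin.val h
    simp [e] at this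
  have hJI : J ⊆ I := by
    intro i hi
    by_contra hiI
    have hiO : i ∈ O := (mem_union.1 (h ▸ mem_union_left K hi)).resolve_left hiI
    obtain ⟨s, hs⟩ := Finset.card_pos.1 (by rw [hsum (e i)]; exact one_pos)
    have hs := (mem_filter.1 hs).2 i hiO
    rw [upd_of_notMem _ _ (disjoint_left.1 hJK hi)] at hs
    exact he i hs
  refine Subset.antisymm hJI fun i hi => ?_
  by_contra hiJ
  have hiK : i ∈ K := (mem_union.1 (h ▸ mem_union_left O hi : i ∈ J ∪ K)).resolve_left hiJ
  have h2 := Finset.card_le_one.1 (hsum fun _ => 0).le (fun _ => 0)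
    (by simp [Agree, upd]) (restr K (e i)) (by
      refine mem_filter.2 ⟨mem_univ _, fun j hj => ?_⟩
      have : j ≠ i := fun hji => disjoint_left.1 hd hi (hji ▸ hj)
      by_cases hjK : j ∈ K
      · rw [upd_of_mem _ _ hjK]
        exact if_neg this
      · rw [upd_of_notMem _ _ hjK])
  exact he i (congrFun h2 ⟨i, hiK⟩).symm

/-- The channel condition is affine, and two distinct points determine the line through F and G. -/
theorem isChannel_of_combinations {I O : Finset QSystem} {F G : GConf → GConf → ℂ} {s t : ℝ}
    (hst : s ≠ t) (hs : IsChannel I O (((1 - s : ℝ) : ℂ) • F + (s : ℂ) • G))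
    (ht : IsChannel I O (((1 - t : ℝ) : ℂ) • F + (t : ℂ) • G)) :
    IsChannel I O F ∧ IsChannel I O G := by
  have hne : ((t : ℂ) - s) ≠ 0 := sub_ne_zero.2 fun h => hst (Complex.ofReal_injective h).symm
  have key : ∀ g g', ∑ k : Conf O, F (upd g k) (upd g' k) = delta I g g' ∧
      ∑ k : Conf O, G (upd g k) (upd g' k) = delta I g g' := by
    intro g g'
    have h1 := hs g g'
    have h2 := ht g g'
    simp only [Pi.add_apply, Pi.smul_apply, Finset.sum_add_distrib, smul_eq_mul,
      ← Finset.mul_sum] at h1 h2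
    push_cast at h1 h2
    constructor
    · refine mul_left_cancel₀ hne ?_
      linear_combination (t : ℂ) * h1 - (s : ℂ) * h2
    · refine mul_left_cancel₀ hne ?_
      linear_combination (1 - (s : ℂ)) * h2 - (1 - (t : ℂ)) * h1
  exact ⟨fun g g' => (key g g').1, fun g g' => (key g g').2⟩

theorem isChannel_gcontract {x : HType} (hx : x.NoRepeat) {A B : QSystem}
    (hA : A ∈ x.inputs) (hB : B ∈ x.outputs) (h : ContractionAdmissible A B x)
    {F : GConf → GConf → ℂ} (hF : x.GDet F) :
    IsChannel (x.inputs \ {A}) (x.outputs \ {B}) (gcontract A B F) := by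
  have hAe := x.inputs_subset_ele hA
  have hBe := x.outputs_subset_ele hB
  have hd := x.disjoint_inputs_outputs
  have hAO : A ∉ x.outputs := disjoint_left.1 hd hA
  have hBI : B ∉ x.inputs := disjoint_right.1 hd hB
  have hT : (x.inputs \ {A}) ∪ (x.outputs \ {B}) = x.ele \ {A, B} := by
    rw [← x.inputs_union_outputs]
    ext i
    have h1 : i = A → i ∉ x.outputs := fun h => h ▸ hAO
    have h2 : i = B → i ∉ x.inputs := fun h => h ▸ hBI
    simp only [mem_union, mem_sdiff, mem_insert, mem_singleton]
    tauto
  have hd' : Disjoint (x.inputs \ {A}) (x.outputs \ {B}) := hd.mono sdiff_subset sdiff_subset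
  let F₀ := pureOn x.inputs (indicator x.outputs fun _ => 0)
  -- Any injective sequence in [0, 1] would do.
  let t : ℕ → ℝ := fun n => 1 / ((n : ℝ) + 1)
  have ht0 : ∀ n, 0 ≤ t n := fun n => Nat.one_div_pos_of_nat.le
  have ht1 : ∀ n, t n ≤ 1 := fun n => by
    refine (div_le_one (by positivity)).2 ?_
    have : (0 : ℝ) ≤ n := Nat.cast_nonneg n
    linarith
  have htinj : ∀ m n, t m = t n → m = n := fun m n hmn => by
    simpa [t] using hmn
  have hdet := fun n => hx.regular.convex F F₀ hF (gDet_pureOn_indicator hx _) (t n) (ht0 n) (ht1 n)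
  choose z hz hze hzd using fun n => h.exists_gDet hAe hBe (hdet n)
  -- The pigeonhole: the inputs of `z n` form a subset of the fixed finite set `x.ele \ {A, B}`.
  obtain ⟨m, n, hmn, e⟩ := Finite.exists_ne_map_eq_of_infinite
    fun n => (⟨(z n).inputs, mem_powerset.2 ((hze n) ▸ (z n).inputs_subset_ele)⟩ :
      (x.ele \ {A, B}).powerset)
  have e : (z m).inputs = (z n).inputs := congrArg Subtype.val e
  have e' : (z m).outputs = (z n).outputs := by rw [HType.outputs, HType.outputs, e, hze, hze]
  have hm := (hz m).regular.isChannel _ (hzd m)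
  have hn := (hz n).regular.isChannel _ (hzd n)
  rw [gcontract_combination] at hm hn
  rw [e, e'] at hm
  obtain ⟨h1, h2⟩ := isChannel_of_combinations (fun k => hmn (htinj _ _ k)) hm hn
  rw [gcontract_pureOn hd hA hB] at h2
  have hin := eq_of_isChannel_pureOn hd' (z n).disjoint_inputs_outputs
    (by rw [HType.inputs_union_outputs, hze, hT]) h2
  have hout : (z n).outputs = x.outputs \ {B} := by
    rw [HType.outputs, hin, hze, ← hT, union_sdiff_cancel_left hd']
  rwa [hin, hout] at h1

theorem contract_isDeterministic {x : HType} (hx : x.NoRepeat) {A B : QSystem}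
    (hA : A ∈ x.inputs) (hB : B ∈ x.outputs) (h : ContractionAdmissible A B x) (R : Op x.ele)
    (hR : x.IsDeterministic R) :
    (HType.arrow (.elem (x.inputs \ {A})) (.elem (x.outputs \ {B}))).IsDeterministic
      (contract A B R) := by
  have hAe := x.inputs_subset_ele hA
  have hBe := x.outputs_subset_ele hB
  have hd := x.disjoint_inputs_outputs
  have hF := ((HType.isDeterministic_iff R).1 hR).2
  have hS : (x.ele \ {A, B}) ∪ ({A, B} \ x.ele) = (x.inputs \ {A}) ∪ (x.outputs \ {B}) := by
    rw [← x.inputs_union_outputs]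
    ext i
    have h1 : i = A → i ∉ x.outputs := fun h => h ▸ disjoint_left.1 hd hA
    have h2 : i = B → i ∉ x.inputs := fun h => h ▸ disjoint_right.1 hd hB
    have h3 : i = A → i ∈ x.inputs := fun h => h ▸ hA
    have h4 : i = B → i ∈ x.outputs := fun h => h ▸ hB
    simp only [mem_union, mem_sdiff, mem_insert, mem_singleton]
    tauto
  refine (HType.isDeterministic_iff _).2 ⟨hS, ?_⟩
  refine IsChannel.elem_arrow_elem (hd.mono sdiff_subset sdiff_subset) ?_ ?_ ?_
  · rw [← hS]
    exact depOn_lift _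
  -- Positivity is inherited from whichever type z admissibility provides.
  · obtain ⟨z, hz, -, hzd⟩ := h.exists_gDet hAe hBe hF
    rw [lift_contract hAe hBe]
    exact hz.regular.pos _ hzd
  · rw [lift_contract hAe hBe]
    exact isChannel_gcontract hx hA hB h hF

theorem mainTheorem4 (x : HType) (hx : x.NoRepeat) (A B : QSystem)
    (hA : A ∈ x.ele) (hB : B ∈ x.ele) (hAB : A ≠ B) (hdim : A.dim = B.dim) :
    ((A ∈ x.inputs ∧ B ∈ x.inputs) ∨ (A ∈ x.outputs ∧ B ∈ x.outputs) →
      ¬ ContractionAdmissible A B x) ∧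
    (A ∈ x.inputs → B ∈ x.outputs →
      (ContractionAdmissible A B x ↔
        ∀ R : Op x.ele, x.IsDeterministic R →
          (HType.arrow (HType.elem (x.inputs \ {A})) (HType.elem (x.outputs \ {B}))).IsDeterministic
            (contract A B R))) := by
  refine ⟨?_, fun hA' hB' => ⟨fun h R hR => contract_isDeterministic hx hA' hB' h R hR,
    fun h R hR => ⟨_, ?_, h R hR⟩⟩⟩
  · rintro (⟨hA', hB'⟩ | ⟨hA', hB'⟩)
    · exact not_admissible_of_inputs hx hA' hB'
    · exact not_admissible_of_outputs hx hAB hA' hB'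
  · exact ⟨trivial, trivial, x.disjoint_inputs_outputs.mono sdiff_subset sdiff_subset⟩
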